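/- Let $n,m\ge 0$ be integers. Write $\mathbb T=\{|z|=1\}$, $\mathbb D=\{|z|<1\}$, $\overline{\mathbb D}=\{|z|\le 1\}$. Let $\mathcal L_{n,m}=\operatorname{span}\{z^sw^t: |s|\le n,\ |t|\le m\}$ and $\mathcal P_{j,k}=\operatorname{span}\{z^sw^t: 0\le s\le j,\ 0\le t\le k\}$ (zero if $j<0$ or $k<0$). Let $\mathcal T:\mathcal L_{n,m}\to\mathbb C$ be a positive linear form, i.e. a linear map with $\mathcal T(f(z,w)\bar f(1/z,1/w))>0$ for all nonzero $f\in\mathcal P_{n,m}$, where $\bar f(z,w)=\overline{f(\bar z,\bar w)}$. Let $\mathcal H_{\mathcal T}$ be the space $\mathcal P_{n,m}$ with inner product $\langle f,g\rangle=\mathcal T(f(z,w)\bar g(1/z,1/w))$; orthogonality, norms and orthogonal projections $P$ are taken in $\mathcal H_{\mathcal T}$. Put $\mathcal E^1_{j,m}=\mathcal P_{j,m}\ominus w\mathcal P_{j,m-1}$ for $j\in\{n-1,n\}$. A pair $(\mathcal K_1,\mathcal K_2)$ of subspaces is a *shift-split* if $\mathcal E^1_{n-1,m}=\mathcal K_1\oplus\mathcal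 K_2$ (orthogonal direct sum), $\mathcal K_1\perp z\mathcal K_2$, and $\mathcal K_1,\,z\mathcal K_2\subset\mathcal E^1_{n,m}$. The form $\mathcal T$ satisfies the *split-shift condition* if a shift-split exists. A *split-poly* associated to the shift-split $(\mathcal K_1,\mathcal K_2)$ is a unit vector $p\in\mathcal E^1_{n,m}\ominus(\mathcal K_1\oplus z\mathcal K_2)$. A polynomial in $\mathbb C[z]$ is *stable* if it has no zeros in $\overline{\mathbb D}$. For $0\ne q\in\mathbb C[z]$ let $\overleftarrow{q}(z)=z^{\deg q}\,\overline{q(1/\bar z)}$. Suppose that $\mathcal T$ satisfies the split-shift condition. Then there exist $g\in\mathbb C[z,w]$ with no zeros on $\mathbb T\times\overline{\mathbb D}$ and no irreducible factor in $\mathbb C[z]$, and a stable $q\in\mathbb C[z]$, such that $q(z)g(z,w)$ is a split-poly (associated to some shift-split), and such that the following holds. There are $g_1,g_2\in\mathbb C[z]$ with $g(z,0)=g_1(z)g_2(z)$, where $g_1$ has no zeros in $\overline{\mathbb D}$ and all zeros of $g_2$ lie in $\mathbb D$. For every split-poly $p$: 1. there are $q_1,q_2\in\mathbb C[z]$ with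 $p(z,w)=q_1(z)q_2(z)g(z,w)$, $\deg(q_1q_2)\le n-\deg_z g$ and $q=q_1\overleftarrow{q_2}$; 2. for all $q_1,q_2\in\mathbb C[z]$ with $p=q_1q_2g$ and $q=q_1\overleftarrow{q_2}$, every shift-split $(\mathcal K_1,\mathcal K_2)$ to which $p$ is associated is given by $$\mathcal K_1=\operatorname{span}P_{\mathcal E^1_{n-1,m}}\{z^jq_1(z)g_1(z):\ 0\le j<\deg q_2+\deg g_2\},$$ $$\mathcal K_2=\operatorname{span}P_{\mathcal E^1_{n-1,m}}\{z^jq_2(z)g_2(z):\ 0\le j<n-\deg q_2-\deg g_2\}.$$ -/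

import Mathlib

open Polynomial
open scoped Polynomial.Bivariate

/- Polynomials in `ℂ[z,w]` are elements of `ℂ[X][Y]`: the inner variable is `z`, the outer one is
`w`, and `Polynomial.evalEval z w f` is the value `f(z,w)`. -/

namespace SplitShift

noncomputable section

/-- Laurent polynomials in `z, w`; `single (s, t) a` is `a z^s w^t`. -/
abbrev Laurent2 : Type := AddMonoidAlgebra ℂ (ℤ × ℤ)

/-- The monomial `z^s w^t`. -/
def mono (s t : ℕ) : ℂ[X][Y] := C (X ^ s) * X ^ t

/-- The space `𝓛_{n,m}` of Laurent polynomials. -/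
def laurentSpace (n m : ℕ) : Submodule ℂ Laurent2 :=
  Submodule.span ℂ {f | ∃ s t : ℤ, |s| ≤ n ∧ |t| ≤ m ∧ f = AddMonoidAlgebra.single (s, t) 1}

/-- The space `𝓟_{j,k}` of polynomials of degree at most `j` in `z` and at most `k` in `w`
(the zero space if `j` or `k` is negative). -/
def polySpace (j k : ℤ) : Submodule ℂ ℂ[X][Y] :=
  Submodule.span ℂ {f | ∃ s t : ℕ, (s : ℤ) ≤ j ∧ (t : ℤ) ≤ k ∧ f = mono s t}

/-- A polynomial, viewed as a Laurent polynomial. -/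
def toLaurent : ℂ[X][Y] →+* Laurent2 :=
  eval₂RingHom
    (eval₂RingHom AddMonoidAlgebra.singleZeroRingHom (AddMonoidAlgebra.single (1, 0) 1))
    (AddMonoidAlgebra.single (0, 1) 1)

/-- `f ↦ f̄(1/z, 1/w)`: conjugate the coefficients and invert both variables. -/
def conjInv : Laurent2 →+* Laurent2 :=
  (AddMonoidAlgebra.mapRingHom (ℤ × ℤ) (starRingEnd ℂ)).comp
    (AddMonoidAlgebra.mapDomainRingHom ℂ (-AddMonoidHom.id (ℤ × ℤ)))

theorem conjInv_single (s t : ℤ) (a : ℂ) :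
    conjInv (AddMonoidAlgebra.single (s, t) a) =
      AddMonoidAlgebra.single (-s, -t) (starRingEnd ℂ a) := by
  simp [conjInv]

theorem toLaurent_mono (s t : ℕ) :
    toLaurent (mono s t) = AddMonoidAlgebra.single ((s : ℤ), (t : ℤ)) 1 := by
  simp only [toLaurent, mono, map_mul, map_pow, coe_eval₂RingHom, eval₂_C, eval₂_X,
    AddMonoidAlgebra.single_pow, AddMonoidAlgebra.single_mul_single]
  simp

theorem smul_eq_single_mul (a : ℂ) (f : Laurent2) :
    a • f = AddMonoidAlgebra.single (0, 0) a * f := by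
  have : a • f = (a • (1 : Laurent2)) * f := by simp
  rw [this, AddMonoidAlgebra.one_def, AddMonoidAlgebra.smul_single, smul_eq_mul, mul_one]
  rfl

theorem toLaurent_smul (a : ℂ) (f : ℂ[X][Y]) : toLaurent (a • f) = a • toLaurent f := by
  have : a • f = C (C a) * f := by
    ext
    simp
  have h : toLaurent (C (C a)) = AddMonoidAlgebra.single (0, 0) a := by
    simp only [toLaurent, coe_eval₂RingHom, eval₂_C]
    rfl
  rw [this, map_mul, smul_eq_single_mul, h]

theorem conjInv_smul (a : ℂ) (f : Laurent2) :
    conjInv (a • f) = (starRingEnd ℂ a) • conjInv f := by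
  rw [smul_eq_single_mul, smul_eq_single_mul, map_mul, conjInv_single]
  simp

/-- `f(z,w) ḡ(1/z,1/w) ∈ 𝓛_{n,m}` for `f, g ∈ 𝓟_{n,m}`. -/
theorem mul_conjInv_mem {n m : ℕ} {f g : ℂ[X][Y]}
    (hf : f ∈ polySpace n m) (hg : g ∈ polySpace n m) :
    toLaurent f * conjInv (toLaurent g) ∈ laurentSpace n m := by
  induction hf using Submodule.span_induction with
  | zero => simp
  | add x y _ _ hx hy => rw [map_add, add_mul]; exact add_mem hx hy
  | smul a x _ hx =>
    rw [toLaurent_smul, smul_mul_assoc]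
    exact Submodule.smul_mem _ _ hx
  | mem x hx =>
    obtain ⟨s, t, hs, ht, rfl⟩ := hx
    induction hg using Submodule.span_induction with
    | zero => simp
    | add x y _ _ hx hy => rw [map_add, map_add, mul_add]; exact add_mem hx hy
    | smul a x _ hx =>
      rw [toLaurent_smul, conjInv_smul, mul_smul_comm]
      exact Submodule.smul_mem _ _ hx
    | mem y hy =>
      obtain ⟨s', t', hs', ht', rfl⟩ := hy
      apply Submodule.subset_span
      refine ⟨(s : ℤ) - s', (t : ℤ) - t', ?_, ?_, ?_⟩
      · rw [abs_le]; constructor <;> omega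
      · rw [abs_le]; constructor <;> omega
      · rw [toLaurent_mono, toLaurent_mono, conjInv_single, AddMonoidAlgebra.single_mul_single]
        simp [sub_eq_add_neg]

/-- The Laurent polynomial `f(z,w) ḡ(1/z,1/w)`, as an element of `𝓛_{n,m}`. -/
def mulConj {n m : ℕ} (f g : polySpace n m) : laurentSpace n m :=
  ⟨toLaurent f * conjInv (toLaurent g), mul_conjInv_mem f.2 g.2⟩

/-- A positive linear form on `𝓛_{n,m}`: `T(f(z,w) f̄(1/z,1/w)) > 0` (a positive real number) for
every nonzero `f ∈ 𝓟_{n,m}`. -/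
structure PositiveForm (n m : ℕ) where
  /-- the linear form -/
  form : laurentSpace n m →ₗ[ℂ] ℂ
  re_pos : ∀ f : polySpace n m, f ≠ 0 → 0 < (form (mulConj f f)).re
  im_zero : ∀ f : polySpace n m, f ≠ 0 → (form (mulConj f f)).im = 0

variable {n m : ℕ}

/-- `⟨f, g⟩_T = T(f(z,w) ḡ(1/z,1/w))`, linear in `f` and conjugate linear in `g`. -/
def PositiveForm.ip (T : PositiveForm n m) (f g : polySpace n m) : ℂ := T.form (mulConj f g)

theorem PositiveForm.ip_add_left (T : PositiveForm n m) (f g h : polySpace n m) :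
    T.ip (f + g) h = T.ip f h + T.ip g h := by
  simp only [ip, ← map_add]
  congr 1
  ext1
  simp [mulConj, add_mul]

theorem PositiveForm.ip_add_right (T : PositiveForm n m) (f g h : polySpace n m) :
    T.ip f (g + h) = T.ip f g + T.ip f h := by
  simp only [ip, ← map_add]
  congr 1
  ext1
  simp [mulConj, mul_add]

theorem PositiveForm.ip_smul_left (T : PositiveForm n m) (a : ℂ) (f g : polySpace n m) :
    T.ip (a • f) g = a * T.ip f g := by
  simp only [ip, ← smul_eq_mul, ← map_smul]
  congr 1
  ext1
  simp [mulConj, toLaurent_smul]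

theorem PositiveForm.ip_smul_right (T : PositiveForm n m) (a : ℂ) (f g : polySpace n m) :
    T.ip f (a • g) = starRingEnd ℂ a * T.ip f g := by
  simp only [ip, ← smul_eq_mul, ← map_smul]
  congr 1
  ext1
  simp [mulConj, toLaurent_smul, conjInv_smul]

theorem PositiveForm.ip_self_im (T : PositiveForm n m) (f : polySpace n m) :
    (T.ip f f).im = 0 := by
  by_cases h : f = 0
  · subst h
    have := T.ip_smul_left 0 0 0
    simp only [zero_smul, zero_mul] at this
    simp [this]
  · exact T.im_zero f h

theorem PositiveForm.ip_conj_symm (T : PositiveForm n m) (f g : polySpace n m) :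
    starRingEnd ℂ (T.ip f g) = T.ip g f := by
  have h1 := T.ip_self_im (f + g)
  have h2 := T.ip_self_im (f + Complex.I • g)
  simp only [T.ip_add_left, T.ip_add_right, T.ip_smul_left, T.ip_smul_right, Complex.add_im,
    Complex.mul_im, Complex.mul_re, Complex.I_re, Complex.I_im, Complex.conj_I, Complex.neg_re,
    Complex.neg_im, T.ip_self_im] at h1 h2
  apply Complex.ext
  · simp only [Complex.conj_re]; linarith
  · simp only [Complex.conj_im]; linarith

/-- The space `𝓗_T`: the vector space `𝓟_{n,m}`, with the inner product given by `T`. -/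
def HT (_T : PositiveForm n m) : Type := polySpace n m

instance (T : PositiveForm n m) : AddCommGroup (HT T) :=
  inferInstanceAs (AddCommGroup (polySpace n m))

instance (T : PositiveForm n m) : Module ℂ (HT T) :=
  inferInstanceAs (Module ℂ (polySpace n m))

/-- Mathlib's inner product is linear in its second argument, so `inner ℂ f g = ⟨g, f⟩_T`. -/
abbrev htCore (T : PositiveForm n m) : InnerProductSpace.Core ℂ (HT T) where
  inner f g := T.ip g f
  conj_inner_symm f g := T.ip_conj_symm f g
  re_inner_nonneg f := by
    by_cases h : f = 0
    · subst h
      have := T.ip_smul_left 0 0 0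
      simp only [zero_smul, zero_mul] at this
      exact le_of_eq (congrArg Complex.re this).symm
    · exact (T.re_pos f h).le
  add_left f g h := T.ip_add_right h f g
  smul_left f g a := T.ip_smul_right a g f
  definite f hf := by
    by_contra h
    have := T.re_pos f h
    exact absurd (congrArg Complex.re hf) this.ne'

instance (T : PositiveForm n m) : NormedAddCommGroup (HT T) :=
  (htCore T).toNormedAddCommGroup

instance (T : PositiveForm n m) : InnerProductSpace ℂ (HT T) :=
  InnerProductSpace.ofCore (htCore T).toCore

instance (T : PositiveForm n m) : FiniteDimensional ℂ (HT T) := by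
  have hfin : {f : ℂ[X][Y] | ∃ s t : ℕ, (s : ℤ) ≤ (n : ℤ) ∧ (t : ℤ) ≤ (m : ℤ) ∧
      f = mono s t}.Finite := by
    refine ((Set.finite_Iic (n, m)).image fun x : ℕ × ℕ => mono x.1 x.2).subset ?_
    rintro f ⟨s, t, hs, ht, rfl⟩
    exact ⟨(s, t), ⟨by exact_mod_cast hs, by exact_mod_cast ht⟩, rfl⟩
  exact FiniteDimensional.span_of_finite ℂ hfin

theorem inner_eq (T : PositiveForm n m) (f g : HT T) : inner ℂ f g = T.ip g f := rfl

/-- The polynomial underlying an element of `𝓗_T`. -/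
def toPoly (T : PositiveForm n m) : HT T →ₗ[ℂ] ℂ[X][Y] := (polySpace n m).subtype

/-- A space of polynomials, as a subspace of `𝓗_T` (its intersection with `𝓟_{n,m}`). -/
def inH (T : PositiveForm n m) (S : Submodule ℂ ℂ[X][Y]) : Submodule ℂ (HT T) :=
  S.comap (toPoly T)

/-- `u S = {u f : f ∈ S}` for a polynomial `u` and a space `S` of polynomials. -/
def mulSpace (u : ℂ[X][Y]) (S : Submodule ℂ ℂ[X][Y]) : Submodule ℂ ℂ[X][Y] :=
  S.map (LinearMap.mulLeft ℂ u)

/-- `𝓔¹_{j,k} = 𝓟_{j,k} ⊖ w 𝓟_{j,k-1}`, the orthogonal complement being taken in `𝓗_T`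
(used for `j ≤ n` and `k ≤ m`). -/
def E1 (T : PositiveForm n m) (j k : ℤ) : Submodule ℂ (HT T) :=
  inH T (polySpace j k) ⊓ (inH T (mulSpace (mono 0 1) (polySpace j (k - 1))))ᗮ

/-- `zK = {z f : f ∈ K}` for a subspace `K` of `𝓗_T` (used for `K ⊆ 𝓟_{n-1,m}`, so that
`zK ⊆ 𝓟_{n,m}`). -/
def zShift (T : PositiveForm n m) (K : Submodule ℂ (HT T)) : Submodule ℂ (HT T) :=
  inH T (mulSpace (mono 1 0) (K.map (toPoly T)))

/-- `(K₁, K₂)` is a shift-split. -/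
structure IsShiftSplit (T : PositiveForm n m) (K₁ K₂ : Submodule ℂ (HT T)) : Prop where
  /-- `𝓔¹_{n-1,m}` is the orthogonal direct sum of `K₁` and `K₂`. -/
  sup_eq : K₁ ⊔ K₂ = E1 T (n - 1) m
  ortho : K₁ ⟂ K₂
  ortho_shift : K₁ ⟂ zShift T K₂
  le : K₁ ≤ E1 T n m
  shift_le : zShift T K₂ ≤ E1 T n m

/-- The split-shift orthogonality condition. -/
def SplitShiftCondition (T : PositiveForm n m) : Prop :=
  ∃ K₁ K₂ : Submodule ℂ (HT T), IsShiftSplit T K₁ K₂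

/-- `p` is a split-poly associated to `(K₁, K₂)`: `(K₁, K₂)` is a shift-split and `p` is a
unit vector of `𝓔¹_{n,m} ⊖ (K₁ ⊕ z K₂)`. -/
def IsSplitPolyOf (T : PositiveForm n m) (K₁ K₂ : Submodule ℂ (HT T)) (p : ℂ[X][Y]) : Prop :=
  IsShiftSplit T K₁ K₂ ∧
    ∃ f : HT T, toPoly T f = p ∧ f ∈ E1 T n m ⊓ (K₁ ⊔ zShift T K₂)ᗮ ∧ ‖f‖ = 1

/-- `p` is a split-poly of `T`, i.e. it is associated to some shift-split. -/
def IsSplitPoly (T : PositiveForm n m) (p : ℂ[X][Y]) : Prop :=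
  ∃ K₁ K₂ : Submodule ℂ (HT T), IsSplitPolyOf T K₁ K₂ p

/-- The linear span of `P_{𝓔¹_{n-1,m}} {z^j a(z) : 0 ≤ j < N}`. -/
def projSpan (T : PositiveForm n m) (a : ℂ[X]) (N : ℕ) : Submodule ℂ (HT T) :=
  Submodule.span ℂ ((E1 T (n - 1) m).starProjection ''
    {f | ∃ j < N, toPoly T f = C (X ^ j * a)})

/-- The degree of `g(z,w)` in `z`. -/
def degZ (g : ℂ[X][Y]) : ℕ := g.support.sup fun k => (g.coeff k).natDegree

/-- The reflection `z^{deg q} q̄(1/z)` of `q ∈ ℂ[z]` at its own degree. -/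
def reflection (q : ℂ[X]) : ℂ[X] := (q.map (starRingEnd ℂ)).reverse

/-- No zeros on `𝕋 × closed disk`. -/
def NoZerosTD (g : ℂ[X][Y]) : Prop :=
  ∀ z w : ℂ, ‖z‖ = 1 → ‖w‖ ≤ 1 → g.evalEval z w ≠ 0

/-- No irreducible factor of `g` is a polynomial in `z` alone. -/
def NoFactorInZ (g : ℂ[X][Y]) : Prop :=
  ∀ f : ℂ[X][Y], Irreducible f → f ∣ g → ¬ ∃ r : ℂ[X], f = C r

/-- No zeros on the closed unit disk. -/
def Stable (q : ℂ[X]) : Prop := ∀ z : ℂ, ‖z‖ ≤ 1 → q.eval z ≠ 0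

/-- All zeros lie in the open unit disk. -/
def AllZerosInDisk (q : ℂ[X]) : Prop := ∀ z : ℂ, q.eval z = 0 → ‖z‖ < 1

end

end SplitShift

namespace SplitShift

noncomputable section

variable {n m : ℕ}

/-! Setting w = 0 identifies 𝓔¹_{j,m} with the polynomials in z of degree at most j, so everything
can be read off from traces at w = 0 and from reproducing kernels.

Let Δ_k(w,η) be the kernel of 𝓟_{n,k} minus that of 𝓟_{n-1,k}, both z-arguments being the same point
of 𝕋. A shift-split with split-poly p gives Δ_m = w η̄ Δ_{m-1} + p(z,w) conj p(z,η), because K₂ and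
zK₂ have the same kernel there (`IsShiftSplit.ker_sub`). Reflecting gives Δ_m = Δ_{m-1} + p*(z,w)
conj p*(z,η), where p* is p reflected (`IsShiftSplit.ker_sub_rev`). Together with Δ_m > 0 on the
diagonal, the two identities exclude zeros of p on 𝕋 × closed disk. The first also shows that p(z,w)
conj p(z,η) is the same for all split-polys. Hence all of them are multiples c(z) g of one primitive
g, with |c| prescribed on 𝕋.

At w = 0, comparing the kernels of 𝓟_{n-1,m} and z𝓟_{n-1,m} with that of 𝓗_T bounds the traces of K₁
by p(z,0) for |z| > 1 and those of K₂ for |z| < 1. This forces divisibility by the parts of p(z,0)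
with zeros outside and inside the disk; counting dimensions gives the formulas for K₁ and K₂
(`IsShiftSplit.eq_projSpan`).

If p = (z - α) h with |α| < 1, then h lies in K₁, and moving h from K₁ to K₂ gives a shift-split
with split-poly (1 - ᾱ z) h (`IsShiftSplit.flip`). Repeating this makes the factor in z stable,
which produces q; a stable polynomial is fixed by its modulus on 𝕋 up to a unimodular constant
(`Stable.eq_of_norm_eq`), which yields q = q₁ · reflection of q₂. -/

/-! ### Coefficients and the polynomial spaces -/

theorem mono_coeff (s t a b : ℕ) :
    ((mono s t).coeff b).coeff a = if a = s ∧ b = t then (1 : ℂ) else 0 := by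
  simp only [mono, coeff_C_mul, coeff_X_pow]
  by_cases hb : b = t <;> simp [hb, coeff_X_pow]

theorem smul_mono (c : ℂ) (s t : ℕ) : c • mono s t = monomial t (monomial s c) := by
  ext a b
  simp only [coeff_smul, mono_coeff, coeff_monomial, smul_eq_mul]
  by_cases hb : t = a <;> by_cases ha : s = b <;> simp [hb, ha, coeff_monomial, eq_comm]

theorem eq_sum_mono (f : ℂ[X][Y]) :
    f = ∑ t ∈ f.support, ∑ s ∈ (f.coeff t).support, ((f.coeff t).coeff s) • mono s t := by
  conv_lhs => rw [← sum_monomial_eq f, Polynomial.sum]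
  refine Finset.sum_congr rfl fun t _ => ?_
  conv_lhs => rw [← sum_monomial_eq (f.coeff t), Polynomial.sum, map_sum]
  exact Finset.sum_congr rfl fun s _ => (smul_mono _ _ _).symm

theorem mem_polySpace_iff {j k : ℤ} {f : ℂ[X][Y]} :
    f ∈ polySpace j k ↔ ∀ s t : ℕ, (f.coeff t).coeff s ≠ 0 → (s : ℤ) ≤ j ∧ (t : ℤ) ≤ k := by
  constructor
  · intro hf
    induction hf using Submodule.span_induction with
    | zero => simp
    | add x y _ _ hx hy =>
      intro s t h
      by_cases h1 : (x.coeff t).coeff s = 0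
      · exact hy s t fun h2 => h (by simp [h1, h2])
      · exact hx s t h1
    | smul a x _ hx => exact fun s t h => hx s t fun h2 => h (by simp [h2])
    | mem x hx =>
      obtain ⟨s, t, hs, ht, rfl⟩ := hx
      intro a b h
      rw [mono_coeff] at h
      simp only [ne_eq, ite_eq_right_iff, not_forall] at h
      obtain ⟨⟨rfl, rfl⟩, -⟩ := h
      exact ⟨hs, ht⟩
  · intro h
    rw [eq_sum_mono f]
    refine Submodule.sum_mem _ fun t _ => Submodule.sum_mem _ fun s hs => Submodule.smul_mem _ _ ?_
    obtain ⟨h1, h2⟩ := h s t (mem_support_iff.1 hs)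
    exact Submodule.subset_span ⟨s, t, h1, h2, rfl⟩

theorem polySpace_mono {j k j' k' : ℤ} (hj : j ≤ j') (hk : k ≤ k') :
    polySpace j k ≤ polySpace j' k' := fun f hf => by
  rw [mem_polySpace_iff] at hf ⊢
  exact fun s t h => ⟨(hf s t h).1.trans hj, (hf s t h).2.trans hk⟩

theorem mono_one_zero : mono 1 0 = C X := by simp [mono]

theorem mono_zero_one : mono 0 1 = X := by simp [mono]

theorem C_X_mul_mem {j k : ℤ} {f : ℂ[X][Y]} (hf : f ∈ polySpace (j - 1) k) :
    C X * f ∈ polySpace j k := by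
  rw [mem_polySpace_iff] at hf ⊢
  intro s t h
  rw [coeff_C_mul] at h
  cases s with
  | zero => simp at h
  | succ s =>
    rw [coeff_X_mul] at h
    have := hf s t h
    push_cast
    omega

theorem mem_of_C_X_mul_mem {j k : ℤ} {f : ℂ[X][Y]} (hf : C X * f ∈ polySpace j k) :
    f ∈ polySpace (j - 1) k := by
  rw [mem_polySpace_iff] at hf ⊢
  intro s t h
  have := hf (s + 1) t (by rwa [coeff_C_mul, coeff_X_mul])
  push_cast at this
  omega

theorem X_mul_mem {j k : ℤ} {f : ℂ[X][Y]} (hf : f ∈ polySpace j (k - 1)) :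
    X * f ∈ polySpace j k := by
  rw [mem_polySpace_iff] at hf ⊢
  intro s t h
  cases t with
  | zero => simp at h
  | succ t =>
    rw [coeff_X_mul] at h
    have := hf s t h
    push_cast
    omega

theorem mem_of_X_mul_mem {j k : ℤ} {f : ℂ[X][Y]} (hf : X * f ∈ polySpace j k) :
    f ∈ polySpace j (k - 1) := by
  rw [mem_polySpace_iff] at hf ⊢
  intro s t h
  have := hf s (t + 1) (by rwa [coeff_X_mul])
  push_cast at this
  omega

theorem C_mem_polySpace {j k : ℤ} (hk : 0 ≤ k) {u : ℂ[X]}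
    (hu : ∀ s : ℕ, u.coeff s ≠ 0 → (s : ℤ) ≤ j) : C u ∈ polySpace j k := by
  rw [mem_polySpace_iff]
  intro s t h
  rw [coeff_C] at h
  split_ifs at h with ht
  · exact ⟨hu s h, by omega⟩
  · simp at h

/-! ### Subspaces of 𝓗_T -/

/-- The element of `𝓗_T` with a given underlying polynomial. -/
def ofPoly (T : PositiveForm n m) (f : ℂ[X][Y]) (hf : f ∈ polySpace n m) : HT T := ⟨f, hf⟩

@[simp]
theorem toPoly_ofPoly (T : PositiveForm n m) (f : ℂ[X][Y]) (hf : f ∈ polySpace n m) :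
    toPoly T (ofPoly T f hf) = f := rfl

theorem toPoly_mem (T : PositiveForm n m) (f : HT T) : toPoly T f ∈ polySpace n m := f.2

theorem toPoly_injective (T : PositiveForm n m) : Function.Injective (toPoly T) :=
  Subtype.val_injective

theorem mem_inH {T : PositiveForm n m} {S : Submodule ℂ ℂ[X][Y]} {f : HT T} :
    f ∈ inH T S ↔ toPoly T f ∈ S := Iff.rfl

theorem inH_top (T : PositiveForm n m) : inH T (polySpace n m) = ⊤ :=
  eq_top_iff.2 fun f _ => toPoly_mem T f

theorem inner_eq_of_toLaurent {T : PositiveForm n m} {f g f' g' : HT T}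
    (h : toLaurent (toPoly T f') * conjInv (toLaurent (toPoly T g')) =
      toLaurent (toPoly T f) * conjInv (toLaurent (toPoly T g))) :
    inner ℂ g' f' = inner ℂ g f := by
  rw [inner_eq, inner_eq]
  exact congrArg T.form (Subtype.ext h)

theorem toLaurent_mono_mul_conjInv (s t : ℕ) :
    toLaurent (mono s t) * conjInv (toLaurent (mono s t)) = 1 := by
  rw [toLaurent_mono, conjInv_single, AddMonoidAlgebra.single_mul_single]
  simp [AddMonoidAlgebra.one_def, Prod.zero_eq_mk]

/-- Multiplication by a monomial is isometric. -/
theorem inner_mono_mul {T : PositiveForm n m} {f g f' g' : HT T} (s t : ℕ)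
    (hf : toPoly T f' = mono s t * toPoly T f) (hg : toPoly T g' = mono s t * toPoly T g) :
    inner ℂ g' f' = inner ℂ g f := by
  refine inner_eq_of_toLaurent ?_
  rw [hf, hg, map_mul, map_mul, map_mul, mul_mul_mul_comm, toLaurent_mono_mul_conjInv, one_mul]

/-- `uK = {u f : f ∈ K}`, as a subspace of `𝓗_T`. -/
def mulShift (T : PositiveForm n m) (u : ℂ[X][Y]) (K : Submodule ℂ (HT T)) :
    Submodule ℂ (HT T) := inH T (mulSpace u (K.map (toPoly T)))

theorem zShift_eq_mulShift (T : PositiveForm n m) (K : Submodule ℂ (HT T)) :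
    zShift T K = mulShift T (mono 1 0) K := rfl

theorem mem_mulShift {T : PositiveForm n m} {u : ℂ[X][Y]} {K : Submodule ℂ (HT T)} {f : HT T} :
    f ∈ mulShift T u K ↔ ∃ g ∈ K, toPoly T f = u * toPoly T g := by
  simp only [mulShift, mem_inH, mulSpace, Submodule.mem_map, LinearMap.mulLeft_apply,
    exists_exists_and_eq_and]
  exact exists_congr fun g => and_congr_right fun _ => eq_comm

theorem mem_zShift {T : PositiveForm n m} {K : Submodule ℂ (HT T)} {f : HT T} :
    f ∈ zShift T K ↔ ∃ g ∈ K, toPoly T f = C X * toPoly T g := by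
  rw [zShift_eq_mulShift, mem_mulShift, mono_one_zero]

/-- The elements of `𝓟_{j,k}` in `𝓗_T`. -/
def polyH (T : PositiveForm n m) (j k : ℤ) : Submodule ℂ (HT T) := inH T (polySpace j k)

theorem mem_polyH {T : PositiveForm n m} {j k : ℤ} {f : HT T} :
    f ∈ polyH T j k ↔ toPoly T f ∈ polySpace j k := Iff.rfl

theorem polyH_top (T : PositiveForm n m) : polyH T n m = ⊤ := inH_top T

theorem polyH_mono (T : PositiveForm n m) {j k j' k' : ℤ} (hj : j ≤ j') (hk : k ≤ k') :
    polyH T j k ≤ polyH T j' k' := fun _ hf => polySpace_mono hj hk hf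

/-- `w 𝓟_{j,m-1}`, as a subspace of `𝓗_T`. -/
def wSpace (T : PositiveForm n m) (j : ℤ) : Submodule ℂ (HT T) :=
  mulShift T (mono 0 1) (polyH T j (m - 1))

theorem mem_wSpace {T : PositiveForm n m} {j : ℤ} {f : HT T} :
    f ∈ wSpace T j ↔ ∃ g ∈ polyH T j (m - 1), toPoly T f = X * toPoly T g := by
  rw [wSpace, mem_mulShift, mono_zero_one]

theorem E1_eq (T : PositiveForm n m) {j : ℤ} (hj : j ≤ n) :
    E1 T j m = polyH T j m ⊓ (wSpace T j)ᗮ := by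
  have : inH T (mulSpace (mono 0 1) (polySpace j ((m : ℤ) - 1))) = wSpace T j := by
    ext f
    simp only [mem_inH, mulSpace, Submodule.mem_map, LinearMap.mulLeft_apply, mono_zero_one,
      mem_wSpace]
    constructor
    · rintro ⟨g, hg, h⟩
      exact ⟨ofPoly T g (polySpace_mono hj (by omega) hg), hg, h.symm⟩
    · rintro ⟨g, hg, h⟩
      exact ⟨toPoly T g, hg, h.symm⟩
  rw [E1, this]
  rfl

theorem wSpace_le (T : PositiveForm n m) (j : ℤ) : wSpace T j ≤ polyH T j m := fun f hf => by
  obtain ⟨g, hg, h⟩ := mem_wSpace.1 hf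
  rw [mem_polyH, h]
  exact X_mul_mem hg

theorem wSpace_sup_E1 (T : PositiveForm n m) {j : ℤ} (hj : j ≤ n) :
    wSpace T j ⊔ E1 T j m = polyH T j m := by
  rw [E1_eq T hj, inf_comm, Submodule.sup_orthogonal_inf_of_hasOrthogonalProjection (wSpace_le T j)]

theorem wSpace_ortho_E1 (T : PositiveForm n m) {j : ℤ} (hj : j ≤ n) :
    wSpace T j ⟂ E1 T j m := by
  rw [E1_eq T hj]
  exact (Submodule.isOrtho_orthogonal_right _).mono_right inf_le_right

/-! ### Traces at w = 0 -/

/-- The restriction of `f` to `w = 0`. -/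
def trace (T : PositiveForm n m) : HT T →ₗ[ℂ] ℂ[X] :=
  (Polynomial.lcoeff ℂ[X] 0).restrictScalars ℂ ∘ₗ toPoly T

theorem trace_apply (T : PositiveForm n m) (f : HT T) : trace T f = (toPoly T f).coeff 0 := rfl

theorem mem_wSpace_of_trace {T : PositiveForm n m} {j : ℤ} (hj : j ≤ n) {f : HT T}
    (hf : f ∈ polyH T j m) (h : trace T f = 0) : f ∈ wSpace T j := by
  have h1 : toPoly T f = X * (toPoly T f).divX := by
    conv_lhs => rw [← X_mul_divX_add (toPoly T f)]
    rw [← trace_apply, h]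
    simp
  have h2 : (toPoly T f).divX ∈ polySpace j (m - 1) :=
    mem_of_X_mul_mem (by rw [← h1]; exact hf)
  exact mem_wSpace.2 ⟨ofPoly T _ (polySpace_mono hj (by omega) h2), h2, h1⟩

theorem trace_of_mem_wSpace {T : PositiveForm n m} {j : ℤ} {f : HT T}
    (hf : f ∈ wSpace T j) : trace T f = 0 := by
  obtain ⟨g, -, h⟩ := mem_wSpace.1 hf
  rw [trace_apply, h]
  simp

/-- A difference with zero trace is divisible by w, hence lies in w𝓟_{j,m-1}, to which 𝓔¹_{j,m} is
orthogonal. -/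
theorem eq_of_trace_eq {T : PositiveForm n m} {j : ℤ} (hj : j ≤ n) {f g : HT T}
    (hf : f ∈ E1 T j m) (hg : g ∈ E1 T j m) (h : trace T f = trace T g) : f = g := by
  have h1 : f - g ∈ E1 T j m := sub_mem hf hg
  have h2 : f - g ∈ wSpace T j := by
    refine mem_wSpace_of_trace hj ?_ (by simp [h])
    rw [E1_eq T hj] at h1
    exact h1.1
  have := (wSpace_ortho_E1 T hj).disjoint.le_bot ⟨h2, h1⟩
  exact sub_eq_zero.1 this

/-- On 𝓟_{j,m} the projection only removes a component in w𝓟_{j,m-1}, which is invisible at w = 0.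
-/
theorem trace_starProjection (T : PositiveForm n m) {j : ℤ} (hj : j ≤ n) {f : HT T}
    (hf : f ∈ polyH T j m) : trace T ((E1 T j m).starProjection f) = trace T f := by
  rw [← wSpace_sup_E1 T hj] at hf
  obtain ⟨a, ha, b, hb, rfl⟩ := Submodule.mem_sup.1 hf
  have h1 : (E1 T j m).starProjection a = 0 :=
    Submodule.starProjection_apply_eq_zero_iff _ |>.2 ((wSpace_ortho_E1 T hj) ha)
  rw [map_add, h1, zero_add, map_add, trace_of_mem_wSpace ha, zero_add,
    Submodule.starProjection_eq_self_iff.2 hb]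

theorem trace_coeff {T : PositiveForm n m} {j k : ℤ} {f : HT T} (hf : f ∈ polyH T j k) (s : ℕ)
    (h : (trace T f).coeff s ≠ 0) : (s : ℤ) ≤ j :=
  (mem_polySpace_iff.1 (mem_polyH.1 hf) s 0 h).1

theorem E1_le_polyH (T : PositiveForm n m) (j : ℤ) : E1 T j m ≤ polyH T j m := inf_le_left

theorem exists_trace_eq (T : PositiveForm n m) {j : ℤ} (hj : j ≤ n) {u : ℂ[X]}
    (hu : ∀ s : ℕ, u.coeff s ≠ 0 → (s : ℤ) ≤ j) :
    ∃ f ∈ polyH T j m, toPoly T f = C u ∧ trace T f = u := by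
  have h1 : C u ∈ polySpace j m := C_mem_polySpace (by positivity) hu
  refine ⟨ofPoly T (C u) (polySpace_mono hj le_rfl h1), h1, rfl, ?_⟩
  rw [trace_apply, toPoly_ofPoly, coeff_C_zero]

/-- The trace is a bijection onto the polynomials of degree below j + 1. The case j = -1, needed
when n = 0, is included. -/
theorem finrank_E1 (T : PositiveForm n m) {j : ℤ} (hj : j ≤ n) {N : ℕ} (hN : (N : ℤ) = j + 1) :
    Module.finrank ℂ (E1 T j m) = N := by
  have hmap : (E1 T j m).map (trace T) = degreeLT ℂ N := by
    ext u
    rw [mem_degreeLT, degree_lt_iff_coeff_zero, Submodule.mem_map]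
    constructor
    · rintro ⟨f, hf, rfl⟩ s hs
      by_contra h
      have := trace_coeff (E1_le_polyH T j hf) s h
      omega
    · intro h
      obtain ⟨f, hf, -, hfu⟩ := exists_trace_eq T hj (u := u) fun s hs => by
        by_contra h1
        exact hs (h s (by omega))
      exact ⟨_, Submodule.starProjection_apply_mem _ f, by rw [trace_starProjection T hj hf, hfu]⟩
  have hinj : Function.Injective ((trace T).domRestrict (E1 T j m)) := fun f g h =>
    Subtype.ext (eq_of_trace_eq hj f.2 g.2 h)
  rw [← LinearMap.finrank_range_of_inj hinj, LinearMap.range_domRestrict, hmap,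
    (degreeLTEquiv ℂ N).finrank_eq, Module.finrank_fin_fun]

/-! ### Reproducing kernels -/

/-- Evaluation at `(z, w)`. -/
def evalH (T : PositiveForm n m) (z w : ℂ) : HT T →ₗ[ℂ] ℂ where
  toFun f := (toPoly T f).evalEval z w
  map_add' f g := by simp [evalEval]
  map_smul' a f := by simp [evalEval]

theorem evalH_apply (T : PositiveForm n m) (z w : ℂ) (f : HT T) :
    evalH T z w f = (toPoly T f).evalEval z w := rfl

theorem evalH_zero_right (T : PositiveForm n m) (z : ℂ) (f : HT T) :
    evalH T z 0 f = (trace T f).eval z := by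
  rw [evalH_apply, trace_apply, evalEval, C_0, ← coeff_zero_eq_eval_zero]

/-- The representer in `V` of the evaluation at `(z, w)`. -/
def kern (T : PositiveForm n m) (V : Submodule ℂ (HT T)) (z w : ℂ) : HT T :=
  V.starProjection ((InnerProductSpace.toDual ℂ (HT T)).symm
    (LinearMap.toContinuousLinearMap (evalH T z w)))

theorem kern_mem (T : PositiveForm n m) (V : Submodule ℂ (HT T)) (z w : ℂ) :
    kern T V z w ∈ V := Submodule.starProjection_apply_mem _ _

theorem inner_kern (T : PositiveForm n m) {V : Submodule ℂ (HT T)} (z w : ℂ) {f : HT T}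
    (hf : f ∈ V) : inner ℂ (kern T V z w) f = evalH T z w f := by
  rw [kern, Submodule.inner_starProjection_left_eq_right, Submodule.starProjection_eq_self_iff.2 hf,
    InnerProductSpace.toDual_symm_apply]
  rfl

theorem eq_kern (T : PositiveForm n m) {V : Submodule ℂ (HT T)} {z w : ℂ} {k : HT T} (hk : k ∈ V)
    (h : ∀ f ∈ V, inner ℂ k f = evalH T z w f) : k = kern T V z w := by
  have h1 : k - kern T V z w ∈ V := sub_mem hk (kern_mem T V z w)
  have h2 : inner ℂ (k - kern T V z w) (k - kern T V z w) = 0 := by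
    rw [inner_sub_left, h _ h1, inner_kern T z w h1, sub_self]
  exact sub_eq_zero.1 (inner_self_eq_zero.1 h2)

/-- The reproducing kernel of `V`, with the second argument fixed in `kern`. -/
def ker (T : PositiveForm n m) (V : Submodule ℂ (HT T)) (z w ζ η : ℂ) : ℂ :=
  evalH T z w (kern T V ζ η)

theorem ker_self (T : PositiveForm n m) (V : Submodule ℂ (HT T)) (z w : ℂ) :
    ker T V z w z w = (‖kern T V z w‖ ^ 2 : ℝ) := by
  rw [ker, ← inner_kern T z w (kern_mem T V z w), inner_self_eq_norm_sq_to_K]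
  norm_cast

theorem norm_evalH_le (T : PositiveForm n m) {V : Submodule ℂ (HT T)} (z w : ℂ) {f : HT T}
    (hf : f ∈ V) : ‖evalH T z w f‖ ≤ ‖kern T V z w‖ * ‖f‖ := by
  rw [← inner_kern T z w hf]
  exact norm_inner_le_norm _ _

/-- The norm of the representer is the norm of the evaluation functional, which grows with the
space. -/
theorem kern_norm_mono (T : PositiveForm n m) {V V' : Submodule ℂ (HT T)} (h : V ≤ V') (z w : ℂ) :
    ‖kern T V z w‖ ≤ ‖kern T V' z w‖ := by
  have h1 := norm_evalH_le T z w (h (kern_mem T V z w))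
  rw [← inner_kern T z w (kern_mem T V z w), inner_self_eq_norm_sq_to_K, norm_pow,
    RCLike.norm_ofReal, abs_norm] at h1
  by_contra! h2
  nlinarith [norm_nonneg (kern T V z w), norm_nonneg (kern T V' z w)]

theorem kern_sup (T : PositiveForm n m) {V V' : Submodule ℂ (HT T)} (h : V ⟂ V') (z w : ℂ) :
    kern T (V ⊔ V') z w = kern T V z w + kern T V' z w := by
  symm
  refine eq_kern T (Submodule.add_mem_sup (kern_mem T _ z w) (kern_mem T _ z w)) fun f hf => ?_
  obtain ⟨a, ha, b, hb, rfl⟩ := Submodule.mem_sup.1 hf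
  rw [inner_add_left, inner_add_right, inner_add_right, inner_kern T z w ha, inner_kern T z w hb,
    h.symm.inner_eq (kern_mem T _ z w) ha, h.inner_eq (kern_mem T _ z w) hb, map_add]
  ring

theorem ker_sup (T : PositiveForm n m) {V V' : Submodule ℂ (HT T)} (h : V ⟂ V') (z w ζ η : ℂ) :
    ker T (V ⊔ V') z w ζ η = ker T V z w ζ η + ker T V' z w ζ η := by
  rw [ker, kern_sup T h, map_add, ker, ker]

/-- Multiplication by a monomial is isometric, so it transports the representer; evaluation
contributes the value of the monomial, conjugated. -/
theorem kern_mulShift (T : PositiveForm n m) {V : Submodule ℂ (HT T)} (s t : ℕ) (z w : ℂ)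
    (h : ∀ f ∈ V, mono s t * toPoly T f ∈ polySpace n m) :
    toPoly T (kern T (mulShift T (mono s t) V) z w) =
      starRingEnd ℂ ((mono s t).evalEval z w) • (mono s t * toPoly T (kern T V z w)) := by
  set k := kern T V z w with hk
  have hkV : k ∈ V := kern_mem T V z w
  set k' : HT T := ofPoly T _ (h k hkV)
  have : starRingEnd ℂ ((mono s t).evalEval z w) • k' = kern T (mulShift T (mono s t) V) z w := by
    refine eq_kern T (Submodule.smul_mem _ _ (mem_mulShift.2 ⟨k, hkV, rfl⟩)) fun f hf => ?_
    obtain ⟨g, hg, hfg⟩ := mem_mulShift.1 hf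
    rw [inner_smul_left, inner_mono_mul s t hfg (show toPoly T k' = _ from rfl), hk,
      inner_kern T z w hg, evalH_apply, evalH_apply, hfg]
    simp
  rw [← this, map_smul]
  rfl

theorem ker_mulShift (T : PositiveForm n m) {V : Submodule ℂ (HT T)} (s t : ℕ) (z w ζ η : ℂ)
    (h : ∀ f ∈ V, mono s t * toPoly T f ∈ polySpace n m) :
    ker T (mulShift T (mono s t) V) z w ζ η =
      (mono s t).evalEval z w * starRingEnd ℂ ((mono s t).evalEval ζ η) * ker T V z w ζ η := by
  rw [ker, evalH_apply, kern_mulShift T s t ζ η h, ker, evalH_apply]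
  simp [evalEval]
  ring

theorem ker_zShift (T : PositiveForm n m) {V : Submodule ℂ (HT T)} (z w ζ η : ℂ)
    (h : V ≤ polyH T (n - 1) m) :
    ker T (zShift T V) z w ζ η = z * starRingEnd ℂ ζ * ker T V z w ζ η := by
  rw [zShift_eq_mulShift, ker_mulShift]
  · simp [mono, evalEval]
  · intro f hf
    rw [mono_one_zero]
    exact C_X_mul_mem (h hf)

theorem ker_wSpace (T : PositiveForm n m) {j : ℤ} (hj : j ≤ n) (z w ζ η : ℂ) :
    ker T (wSpace T j) z w ζ η = w * starRingEnd ℂ η * ker T (polyH T j (m - 1)) z w ζ η := by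
  rw [wSpace, ker_mulShift]
  · simp [mono, evalEval]
  · intro f hf
    rw [mono_zero_one]
    exact polySpace_mono hj le_rfl (X_mul_mem hf)

theorem ker_span (T : PositiveForm n m) {p : HT T} (hp : ‖p‖ = 1) (z w ζ η : ℂ) :
    ker T (ℂ ∙ p) z w ζ η = evalH T z w p * starRingEnd ℂ (evalH T ζ η p) := by
  have : starRingEnd ℂ (evalH T ζ η p) • p = kern T (ℂ ∙ p) ζ η := by
    refine eq_kern T (Submodule.smul_mem _ _ (Submodule.mem_span_singleton_self p)) fun f hf => ?_
    obtain ⟨a, rfl⟩ := Submodule.mem_span_singleton.1 hf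
    rw [inner_smul_left, inner_smul_right, inner_self_eq_norm_sq_to_K, hp, map_smul]
    simp [mul_comm]
  rw [ker, ← this, map_smul, smul_eq_mul, mul_comm]

/-! ### Kernel identities from a shift-split -/

section ShiftSplit

variable {T : PositiveForm n m} {K₁ K₂ : Submodule ℂ (HT T)}

theorem IsShiftSplit.le_polyH₂ (h : IsShiftSplit T K₁ K₂) : K₂ ≤ polyH T (n - 1) m :=
  (le_sup_right.trans h.sup_eq.le).trans (E1_le_polyH T _)

theorem finrank_zShift {K : Submodule ℂ (HT T)} (h : K ≤ polyH T (n - 1) m) :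
    Module.finrank ℂ (zShift T K) = Module.finrank ℂ K := by
  have h1 : (zShift T K).map (toPoly T) = (K.map (toPoly T)).map (LinearMap.mulLeft ℂ (C X)) := by
    ext f
    simp only [Submodule.mem_map, LinearMap.mulLeft_apply, exists_exists_and_eq_and]
    constructor
    · rintro ⟨g, hg, rfl⟩
      obtain ⟨k, hk, hgk⟩ := mem_zShift.1 hg
      exact ⟨k, hk, hgk.symm⟩
    · rintro ⟨k, hk, rfl⟩
      exact ⟨ofPoly T _ (C_X_mul_mem (h hk)), mem_zShift.2 ⟨k, hk, rfl⟩, rfl⟩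
  have hX : Function.Injective (LinearMap.mulLeft ℂ (C X : ℂ[X][Y])) := fun a b hab =>
    mul_left_cancel₀ (C_ne_zero.2 X_ne_zero) hab
  rw [(Submodule.equivMapOfInjective _ (toPoly_injective T) (zShift T K)).finrank_eq, h1,
    ← (Submodule.equivMapOfInjective _ hX _).finrank_eq,
    ← (Submodule.equivMapOfInjective _ (toPoly_injective T) K).finrank_eq]

theorem IsShiftSplit.finrank_add (h : IsShiftSplit T K₁ K₂) :
    Module.finrank ℂ K₁ + Module.finrank ℂ K₂ = n := by
  rw [← Submodule.finrank_sup_add_finrank_inf_eq, h.sup_eq, h.ortho.disjoint.eq_bot,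
    finrank_bot, add_zero]
  exact finrank_E1 T (by omega) (by ring)

theorem IsShiftSplit.finrank_shift (h : IsShiftSplit T K₁ K₂) :
    Module.finrank ℂ ↥(K₁ ⊔ zShift T K₂) = n := by
  have := Submodule.finrank_sup_add_finrank_inf_eq K₁ (zShift T K₂)
  rwa [h.ortho_shift.disjoint.eq_bot, finrank_bot, add_zero, finrank_zShift h.le_polyH₂,
    h.finrank_add] at this

/-- The dimensions are n + 1 for 𝓔¹_{n,m} and n for K₁ ⊕ zK₂. So a given shift-split has a
split-poly, unique up to a unimodular constant. -/
theorem IsShiftSplit.finrank_complement (h : IsShiftSplit T K₁ K₂) :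
    Module.finrank ℂ ↥((K₁ ⊔ zShift T K₂)ᗮ ⊓ E1 T n m) = 1 := by
  have h1 := Submodule.finrank_add_inf_finrank_orthogonal (sup_le h.le h.shift_le)
  have h2 : Module.finrank ℂ (E1 T n m) = n + 1 := finrank_E1 T le_rfl (by simp)
  have h3 := h.finrank_shift
  omega

theorem IsShiftSplit.exists_splitPoly (h : IsShiftSplit T K₁ K₂) :
    ∃ p, IsSplitPolyOf T K₁ K₂ p := by
  obtain ⟨v, hv, -⟩ := finrank_eq_one_iff'.1 h.finrank_complement
  have hv0 : (v : HT T) ≠ 0 := fun h0 => hv (Subtype.ext h0)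
  refine ⟨_, h, ((‖(v : HT T)‖ : ℂ)⁻¹) • (v : HT T), rfl, ?_, ?_⟩
  · exact Submodule.smul_mem _ _ ⟨v.2.2, v.2.1⟩
  · rw [norm_smul, norm_inv, Complex.norm_real, norm_norm,
      inv_mul_cancel₀ (norm_ne_zero_iff.2 hv0)]

theorem IsShiftSplit.sup_span (h : IsShiftSplit T K₁ K₂) {p : HT T}
    (hp : p ∈ E1 T n m ⊓ (K₁ ⊔ zShift T K₂)ᗮ) (hp0 : p ≠ 0) :
    K₁ ⊔ zShift T K₂ ⊔ (ℂ ∙ p) = E1 T n m := by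
  have h1 : (ℂ ∙ p) = (K₁ ⊔ zShift T K₂)ᗮ ⊓ E1 T n m := by
    refine Submodule.eq_of_le_of_finrank_eq ?_ ?_
    · rw [Submodule.span_singleton_le_iff_mem]
      exact ⟨hp.2, hp.1⟩
    · rw [h.finrank_complement, finrank_span_singleton hp0]
  rw [h1]
  exact Submodule.sup_orthogonal_inf_of_hasOrthogonalProjection (sup_le h.le h.shift_le)

theorem ortho_span_of_mem {V E : Submodule ℂ (HT T)} {p : HT T} (hp : p ∈ E ⊓ Vᗮ) :
    V ⟂ (ℂ ∙ p) :=
  (Submodule.isOrtho_orthogonal_right V).mono_right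
    ((Submodule.span_singleton_le_iff_mem _ _).2 hp.2)

/-- The kernel of `𝓗_T`, decomposed along a shift-split. -/
theorem IsShiftSplit.ker_top (h : IsShiftSplit T K₁ K₂) {p : HT T}
    (hp : p ∈ E1 T n m ⊓ (K₁ ⊔ zShift T K₂)ᗮ) (hp1 : ‖p‖ = 1) (z w ζ η : ℂ) :
    ker T ⊤ z w ζ η = w * starRingEnd ℂ η * ker T (polyH T n (m - 1)) z w ζ η +
      (ker T K₁ z w ζ η + z * starRingEnd ℂ ζ * ker T K₂ z w ζ η +
        evalH T z w p * starRingEnd ℂ (evalH T ζ η p)) := by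
  have hp0 : p ≠ 0 := by rintro rfl; simp at hp1
  rw [← polyH_top T, ← wSpace_sup_E1 T le_rfl, ker_sup T (wSpace_ortho_E1 T le_rfl),
    ker_wSpace T le_rfl, ← h.sup_span hp hp0, ker_sup T (ortho_span_of_mem hp),
    ker_sup T h.ortho_shift, ker_zShift T _ _ _ _ h.le_polyH₂, ker_span T hp1]

theorem IsShiftSplit.ker_polyH (h : IsShiftSplit T K₁ K₂) (z w ζ η : ℂ) :
    ker T (polyH T (n - 1) m) z w ζ η =
      w * starRingEnd ℂ η * ker T (polyH T (n - 1) (m - 1)) z w ζ η +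
      (ker T K₁ z w ζ η + ker T K₂ z w ζ η) := by
  have hn : (n : ℤ) - 1 ≤ n := by omega
  rw [← wSpace_sup_E1 T hn, ker_sup T (wSpace_ortho_E1 T hn), ker_wSpace T hn, ← h.sup_eq,
    ker_sup T h.ortho]

/-- On 𝕋 the factor z z̄ in front of the kernel of K₂ is 1, so K₁ and K₂ cancel from the difference
and only p remains. -/
theorem IsShiftSplit.ker_sub (h : IsShiftSplit T K₁ K₂) {p : HT T}
    (hp : p ∈ E1 T n m ⊓ (K₁ ⊔ zShift T K₂)ᗮ) (hp1 : ‖p‖ = 1) {z : ℂ} (hz : ‖z‖ = 1) (w η : ℂ) :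
    ker T ⊤ z w z η - ker T (polyH T (n - 1) m) z w z η =
      w * starRingEnd ℂ η * (ker T (polyH T n (m - 1)) z w z η -
        ker T (polyH T (n - 1) (m - 1)) z w z η) +
      evalH T z w p * starRingEnd ℂ (evalH T z η p) := by
  have hz1 : z * starRingEnd ℂ z = 1 := by rw [Complex.mul_conj, Complex.normSq_eq_norm_sq, hz]; simp
  rw [h.ker_top hp hp1, h.ker_polyH, hz1]
  ring

end ShiftSplit

/-! ### The reflection of 𝓗_T -/

/-- The polynomial `z^n w^m f̄(1/z, 1/w)`, for `f ∈ 𝓟_{n,m}`. -/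
def revPoly (n m : ℕ) : ℂ[X][Y] →ₛₗ[starRingEnd ℂ] ℂ[X][Y] where
  toFun f := ∑ s ∈ Finset.range (n + 1), ∑ t ∈ Finset.range (m + 1),
    starRingEnd ℂ ((f.coeff t).coeff s) • mono (n - s) (m - t)
  map_add' f g := by simp [add_smul, Finset.sum_add_distrib]
  map_smul' a f := by simp [mul_smul, Finset.smul_sum]

theorem revPoly_coeff (f : ℂ[X][Y]) (s t : ℕ) :
    ((revPoly n m f).coeff t).coeff s =
      if s ≤ n ∧ t ≤ m then starRingEnd ℂ ((f.coeff (m - t)).coeff (n - s)) else 0 := by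
  change ((∑ s' ∈ Finset.range (n + 1), ∑ t' ∈ Finset.range (m + 1),
    starRingEnd ℂ ((f.coeff t').coeff s') • mono (n - s') (m - t')).coeff t).coeff s = _
  simp only [finsetSum_coeff, coeff_smul, mono_coeff]
  split_ifs with h
  · rw [Finset.sum_eq_single (n - s), Finset.sum_eq_single (m - t)]
    · rw [if_pos (by omega)]
      simp
    · intro b hb hb'
      rw [if_neg (by have := Finset.mem_range.1 hb; omega), smul_zero]
    · intro h; exact absurd (Finset.mem_range.2 (by omega)) h
    · intro b hb hb'
      refine Finset.sum_eq_zero fun t' _ => ?_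
      rw [if_neg (by have := Finset.mem_range.1 hb; omega), smul_zero]
    · intro h; exact absurd (Finset.mem_range.2 (by omega)) h
  · refine Finset.sum_eq_zero fun s' _ => Finset.sum_eq_zero fun t' _ => ?_
    rw [if_neg (by omega), smul_zero]

theorem revPoly_mono {s t : ℕ} (hs : s ≤ n) (ht : t ≤ m) :
    revPoly n m (mono s t) = mono (n - s) (m - t) := by
  ext t' s'
  rw [revPoly_coeff, mono_coeff, mono_coeff]
  by_cases h : s' ≤ n ∧ t' ≤ m
  · rw [if_pos h, apply_ite (starRingEnd ℂ), map_one, map_zero]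
    exact if_congr (by omega) rfl rfl
  · rw [if_neg h, if_neg (by omega)]

theorem revPoly_mem (f : ℂ[X][Y]) : revPoly n m f ∈ polySpace n m := by
  rw [mem_polySpace_iff]
  intro s t h
  rw [revPoly_coeff] at h
  simp only [ne_eq, ite_eq_right_iff, not_forall] at h
  exact_mod_cast h.1

/-- The reflection `f ↦ z^n w^m f̄(1/z, 1/w)` of `𝓗_T`. -/
def rev (T : PositiveForm n m) : HT T →ₛₗ[starRingEnd ℂ] HT T where
  toFun f := ofPoly T (revPoly n m (toPoly T f)) (revPoly_mem _)
  map_add' f g := toPoly_injective T (by simp)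
  map_smul' a f := toPoly_injective T (by simp)

/-- The monomials `z^s w^t` with `s ≤ n`, `t ≤ m`, in `𝓗_T`. -/
def monoH (T : PositiveForm n m) (s t : ℕ) (hs : s ≤ n) (ht : t ≤ m) : HT T :=
  ofPoly T (mono s t) (Submodule.subset_span ⟨s, t, by omega, by omega, rfl⟩)

theorem polyH_eq_span (T : PositiveForm n m) {j k : ℤ} (hj : j ≤ n) (hk : k ≤ m) :
    polyH T j k = Submodule.span ℂ {f | ∃ (s t : ℕ) (hs : s ≤ n) (ht : t ≤ m),
      (s : ℤ) ≤ j ∧ (t : ℤ) ≤ k ∧ f = monoH T s t hs ht} := by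
  apply le_antisymm
  · have key : ∀ g ∈ polySpace j k, ∃ f ∈ Submodule.span ℂ
        {f | ∃ (s t : ℕ) (hs : s ≤ n) (ht : t ≤ m),
          (s : ℤ) ≤ j ∧ (t : ℤ) ≤ k ∧ f = monoH T s t hs ht}, toPoly T f = g := by
      intro g hg
      rw [polySpace] at hg
      induction hg using Submodule.span_induction with
      | zero => exact ⟨0, zero_mem _, map_zero _⟩
      | add x y _ _ hx hy =>
        obtain ⟨f, hf, rfl⟩ := hx
        obtain ⟨f', hf', rfl⟩ := hy
        exact ⟨f + f', add_mem hf hf', map_add _ _ _⟩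
      | smul a x _ hx =>
        obtain ⟨f, hf, rfl⟩ := hx
        exact ⟨a • f, Submodule.smul_mem _ a hf, map_smul _ _ _⟩
      | mem x hx =>
        obtain ⟨s, t, hs, ht, rfl⟩ := hx
        exact ⟨monoH T s t (by omega) (by omega),
          Submodule.subset_span ⟨s, t, _, _, hs, ht, rfl⟩, rfl⟩
    intro f hf
    obtain ⟨f', hf', h⟩ := key _ hf
    rwa [← toPoly_injective T h]
  · rw [Submodule.span_le]
    rintro _ ⟨s, t, hs, ht, h1, h2, rfl⟩
    exact Submodule.subset_span ⟨s, t, h1, h2, rfl⟩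

theorem mem_span_monoH (T : PositiveForm n m) (f : HT T) :
    f ∈ Submodule.span ℂ {f | ∃ (s t : ℕ) (hs : s ≤ n) (ht : t ≤ m),
      (s : ℤ) ≤ n ∧ (t : ℤ) ≤ m ∧ f = monoH T s t hs ht} := by
  rw [← polyH_eq_span T le_rfl le_rfl]
  exact toPoly_mem T f

theorem rev_monoH (T : PositiveForm n m) {s t : ℕ} (hs : s ≤ n) (ht : t ≤ m) :
    rev T (monoH T s t hs ht) = monoH T (n - s) (m - t) (by omega) (by omega) :=
  toPoly_injective T (revPoly_mono hs ht)

theorem rev_rev (T : PositiveForm n m) (f : HT T) : rev T (rev T f) = f := by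
  have hf := mem_span_monoH T f
  induction hf using Submodule.span_induction with
  | zero => simp
  | add f g _ _ hf hg => rw [map_add, map_add, hf, hg]
  | smul a f _ hf => rw [map_smulₛₗ, map_smulₛₗ, hf, Complex.conj_conj]
  | mem f hf =>
    obtain ⟨s, t, hs, ht, -, -, rfl⟩ := hf
    rw [rev_monoH, rev_monoH]
    congr 1 <;> omega

theorem inner_rev (T : PositiveForm n m) (f g : HT T) :
    inner ℂ (rev T f) (rev T g) = inner ℂ g f := by
  have hf := mem_span_monoH T f
  induction hf using Submodule.span_induction with
  | zero => simp
  | add f f' _ _ hf hf' => rw [map_add, inner_add_left, inner_add_right, hf, hf']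
  | smul a f _ hf => rw [map_smulₛₗ, inner_smul_left, inner_smul_right, hf, Complex.conj_conj]
  | mem f hf =>
    obtain ⟨s, t, hs, ht, -, -, rfl⟩ := hf
    have hg := mem_span_monoH T g
    induction hg using Submodule.span_induction with
    | zero => simp
    | add g g' _ _ hg hg' => rw [map_add, inner_add_left, inner_add_right, hg, hg']
    | smul a g _ hg => rw [map_smulₛₗ, inner_smul_left, inner_smul_right, hg]
    | mem g hg =>
      obtain ⟨s', t', hs', ht', -, -, rfl⟩ := hg
      rw [rev_monoH, rev_monoH]
      refine inner_eq_of_toLaurent ?_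
      change toLaurent (mono (n - s') (m - t')) * conjInv (toLaurent (mono (n - s) (m - t))) =
        toLaurent (mono s t) * conjInv (toLaurent (mono s' t'))
      rw [toLaurent_mono, toLaurent_mono, toLaurent_mono, toLaurent_mono, conjInv_single,
        conjInv_single, AddMonoidAlgebra.single_mul_single, AddMonoidAlgebra.single_mul_single]
      congr 1
      push_cast [Nat.cast_sub hs, Nat.cast_sub ht, Nat.cast_sub hs', Nat.cast_sub ht']
      ext <;> simp [← sub_eq_add_neg]

theorem norm_rev (T : PositiveForm n m) (f : HT T) : ‖rev T f‖ = ‖f‖ := by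
  rw [norm_eq_sqrt_re_inner (𝕜 := ℂ), inner_rev, ← norm_eq_sqrt_re_inner]

theorem rev_ortho {T : PositiveForm n m} {V V' : Submodule ℂ (HT T)} (h : V ⟂ V') :
    V.map (rev T) ⟂ V'.map (rev T) := by
  rw [Submodule.isOrtho_iff_inner_eq]
  rintro _ ⟨f, hf, rfl⟩ _ ⟨g, hg, rfl⟩
  rw [inner_rev, h.symm.inner_eq hg hf]

theorem rev_mem_iff {T : PositiveForm n m} {V : Submodule ℂ (HT T)} {f : HT T} :
    f ∈ V.map (rev T) ↔ rev T f ∈ V := by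
  constructor
  · rintro ⟨g, hg, rfl⟩
    rwa [rev_rev]
  · exact fun h => ⟨_, h, rev_rev T f⟩


theorem map_rev_eq {T : PositiveForm n m} {V V' : Submodule ℂ (HT T)}
    (h : ∀ f ∈ V, rev T f ∈ V') (h' : ∀ f ∈ V', rev T f ∈ V) : V.map (rev T) = V' := by
  ext f
  rw [rev_mem_iff]
  exact ⟨fun hf => by simpa [rev_rev] using h _ hf, h' f⟩

theorem coeff_eq_zero {T : PositiveForm n m} (f : HT T) {s t : ℕ} (h : n < s ∨ m < t) :
    ((toPoly T f).coeff t).coeff s = 0 := by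
  by_contra h1
  have := mem_polySpace_iff.1 (toPoly_mem T f) s t h1
  omega

theorem toPoly_rev_coeff {T : PositiveForm n m} (f : HT T) (s t : ℕ) :
    ((toPoly T (rev T f)).coeff t).coeff s =
      if s ≤ n ∧ t ≤ m then starRingEnd ℂ (((toPoly T f).coeff (m - t)).coeff (n - s)) else 0 :=
  revPoly_coeff _ _ _

/-- Reflection inverts z, so the factor z changes sides. -/
theorem rev_of_C_X_mul {T : PositiveForm n m} {f g : HT T} (h : toPoly T g = C X * toPoly T f) :
    toPoly T (rev T f) = C X * toPoly T (rev T g) := by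
  have hc : ∀ s t, ((toPoly T g).coeff t).coeff (s + 1) = ((toPoly T f).coeff t).coeff s := by
    intro s t
    rw [h, coeff_C_mul, coeff_X_mul]
  have hc0 : ∀ t, ((toPoly T g).coeff t).coeff 0 = 0 := by
    intro t
    rw [h, coeff_C_mul, coeff_X_mul_zero]
  have hf : ∀ t, ((toPoly T f).coeff t).coeff n = 0 := fun t => by
    rw [← hc, coeff_eq_zero g (by omega)]
  ext t s
  rw [coeff_C_mul, toPoly_rev_coeff]
  cases s with
  | zero => simp [hf]
  | succ s =>
    rw [coeff_X_mul, toPoly_rev_coeff]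
    by_cases h1 : s + 1 ≤ n ∧ t ≤ m
    · rw [if_pos h1, if_pos (by omega), ← hc]
      congr 3
      omega
    · rw [if_neg h1]
      by_cases h2 : s ≤ n ∧ t ≤ m
      · rw [if_pos h2, show n - s = 0 by omega, hc0, map_zero]
      · rw [if_neg h2]

theorem rev_of_X_mul {T : PositiveForm n m} {f g : HT T} (h : toPoly T g = X * toPoly T f) :
    toPoly T (rev T f) = X * toPoly T (rev T g) := by
  have hc : ∀ t, (toPoly T g).coeff (t + 1) = (toPoly T f).coeff t := by
    intro t
    rw [h, coeff_X_mul]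
  have hc0 : (toPoly T g).coeff 0 = 0 := by
    rw [h, coeff_X_mul_zero]
  have hf : ∀ s, ((toPoly T f).coeff m).coeff s = 0 := fun s => by
    rw [← hc, coeff_eq_zero g (by omega)]
  ext t s
  rw [toPoly_rev_coeff]
  cases t with
  | zero => simp [hf]
  | succ t =>
    rw [coeff_X_mul, toPoly_rev_coeff]
    by_cases h1 : s ≤ n ∧ t + 1 ≤ m
    · rw [if_pos h1, if_pos (by omega), ← hc]
      congr 3
      omega
    · rw [if_neg h1]
      by_cases h2 : s ≤ n ∧ t ≤ m
      · rw [if_pos h2, show m - t = 0 by omega, hc0, coeff_zero, map_zero]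
      · rw [if_neg h2]

theorem exists_C_X_mul {T : PositiveForm n m} {f : HT T} {k : ℤ} (hk : k ≤ m)
    (hf : f ∈ polyH T (n - 1) k) : ∃ g ∈ polyH T n k, toPoly T g = C X * toPoly T f :=
  ⟨ofPoly T _ (polySpace_mono le_rfl hk (C_X_mul_mem hf)), C_X_mul_mem hf, rfl⟩

theorem exists_X_mul {T : PositiveForm n m} {f : HT T} {j : ℤ} (hj : j ≤ n)
    (hf : f ∈ polyH T j (m - 1)) : ∃ g ∈ polyH T j m, toPoly T g = X * toPoly T f :=
  ⟨ofPoly T _ (polySpace_mono hj le_rfl (X_mul_mem hf)), X_mul_mem hf, rfl⟩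

theorem map_rev_wSpace (T : PositiveForm n m) :
    (wSpace T n).map (rev T) = polyH T n (m - 1) := by
  refine map_rev_eq (fun f hf => ?_) fun f hf => ?_
  · obtain ⟨g, -, hfg⟩ := mem_wSpace.1 hf
    exact mem_of_X_mul_mem (by rw [← rev_of_X_mul hfg]; exact toPoly_mem T _)
  · obtain ⟨g, -, hg⟩ := exists_X_mul le_rfl hf
    exact mem_wSpace.2 ⟨rev T g, mem_of_X_mul_mem (by rw [← rev_of_X_mul hg]; exact toPoly_mem T _),
      rev_of_X_mul hg⟩

theorem map_rev_polyH (T : PositiveForm n m) :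
    (polyH T (n - 1) m).map (rev T) = zShift T (polyH T (n - 1) m) := by
  refine map_rev_eq (fun f hf => ?_) fun f hf => ?_
  · obtain ⟨g, -, hg⟩ := exists_C_X_mul le_rfl hf
    exact mem_zShift.2 ⟨rev T g,
      mem_of_C_X_mul_mem (by rw [← rev_of_C_X_mul hg]; exact toPoly_mem T _), rev_of_C_X_mul hg⟩
  · obtain ⟨g, -, hfg⟩ := mem_zShift.1 hf
    exact mem_of_C_X_mul_mem (by rw [← rev_of_C_X_mul hfg]; exact toPoly_mem T _)

theorem map_rev_wSpace_sub (T : PositiveForm n m) :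
    (wSpace T (n - 1)).map (rev T) = zShift T (polyH T (n - 1) (m - 1)) := by
  refine map_rev_eq (fun f hf => ?_) fun f hf => ?_
  · obtain ⟨g, hg, hfg⟩ := mem_wSpace.1 hf
    -- The auxiliary elements zf and zg make both exchange rules of the reflection applicable: zf =
    -- w (zg).
    obtain ⟨f', -, hf'⟩ := exists_C_X_mul le_rfl (wSpace_le T _ hf)
    obtain ⟨g', -, hg'⟩ := exists_C_X_mul (by omega) hg
    have h1 : toPoly T f' = X * toPoly T g' := by rw [hf', hg', hfg]; ring
    refine mem_zShift.2 ⟨rev T f', ?_, rev_of_C_X_mul hf'⟩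
    refine mem_of_X_mul_mem (mem_of_C_X_mul_mem ?_)
    rw [← rev_of_X_mul h1, ← rev_of_C_X_mul hg']
    exact toPoly_mem T _
  · obtain ⟨g, hg, hfg⟩ := mem_zShift.1 hf
    obtain ⟨g', -, hg'⟩ := exists_X_mul (by omega) hg
    have h1 := rev_of_C_X_mul hfg
    refine mem_wSpace_of_trace (by omega)
      (mem_of_C_X_mul_mem (by rw [← h1]; exact toPoly_mem T _)) ?_
    have h2 := congrArg (fun q : ℂ[X][Y] => q.coeff 0) (h1.symm.trans (rev_of_X_mul hg'))
    simp only [coeff_C_mul, coeff_X_mul_zero] at h2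
    exact (mul_eq_zero.1 h2).resolve_left X_ne_zero

theorem map_rev_zShift_le {T : PositiveForm n m} {K : Submodule ℂ (HT T)} :
    (zShift T K).map (rev T) ≤ polyH T (n - 1) m := by
  rintro _ ⟨f, hf, rfl⟩
  obtain ⟨g, -, hfg⟩ := mem_zShift.1 hf
  exact mem_of_C_X_mul_mem (by rw [← rev_of_C_X_mul hfg]; exact toPoly_mem T _)

theorem zShift_map_rev_zShift {T : PositiveForm n m} {K : Submodule ℂ (HT T)}
    (hK : K ≤ polyH T (n - 1) m) : zShift T ((zShift T K).map (rev T)) = K.map (rev T) := by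
  ext f
  rw [mem_zShift]
  constructor
  · rintro ⟨_, ⟨g, hg, rfl⟩, h⟩
    obtain ⟨k, hk, hgk⟩ := mem_zShift.1 hg
    refine ⟨k, hk, toPoly_injective T ?_⟩
    rw [h, rev_of_C_X_mul hgk]
  · rintro ⟨k, hk, rfl⟩
    obtain ⟨g, -, hg⟩ := exists_C_X_mul le_rfl (hK hk)
    exact ⟨rev T g, ⟨g, mem_zShift.2 ⟨k, hk, hg⟩, rfl⟩, rev_of_C_X_mul hg⟩

section

variable {T : PositiveForm n m} {K₁ K₂ : Submodule ℂ (HT T)}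

/-- Reflect the orthogonal decompositions of 𝓗_T and 𝓟_{n-1,m}. Since w𝓟_{n,m-1} goes to 𝓟_{n,m-1},
the factor w η̄ of `IsShiftSplit.ker_sub` disappears. -/
theorem IsShiftSplit.ker_sub_rev (h : IsShiftSplit T K₁ K₂) {p : HT T}
    (hp : p ∈ E1 T n m ⊓ (K₁ ⊔ zShift T K₂)ᗮ) (hp1 : ‖p‖ = 1) {z : ℂ} (hz : ‖z‖ = 1) (w η : ℂ) :
    ker T ⊤ z w z η - ker T (polyH T (n - 1) m) z w z η =
      ker T (polyH T n (m - 1)) z w z η - ker T (polyH T (n - 1) (m - 1)) z w z η +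
      evalH T z w (rev T p) * starRingEnd ℂ (evalH T z η (rev T p)) := by
  have hz1 : z * starRingEnd ℂ z = 1 := by rw [Complex.mul_conj, Complex.normSq_eq_norm_sq, hz]; simp
  have hp0 : p ≠ 0 := by rintro rfl; simp at hp1
  have hn : (n : ℤ) - 1 ≤ n := by omega
  have htop : (⊤ : Submodule ℂ (HT T)).map (rev T) = ⊤ := map_rev_eq (by simp) (by simp)
  have h1 : ker T ⊤ z w z η = ker T (polyH T n (m - 1)) z w z η +
      (ker T (K₁.map (rev T)) z w z η + ker T ((zShift T K₂).map (rev T)) z w z η +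
        evalH T z w (rev T p) * starRingEnd ℂ (evalH T z η (rev T p))) := by
    rw [← htop, ← polyH_top T, ← wSpace_sup_E1 T le_rfl, Submodule.map_sup,
      ker_sup T (rev_ortho (wSpace_ortho_E1 T le_rfl)), map_rev_wSpace, ← h.sup_span hp hp0,
      Submodule.map_sup, ker_sup T (rev_ortho (ortho_span_of_mem hp)), Submodule.map_sup,
      ker_sup T (rev_ortho h.ortho_shift), Submodule.map_span, Set.image_singleton,
      ker_span T ((norm_rev T p).trans hp1)]
  have h2 : ker T (polyH T (n - 1) m) z w z η = ker T (polyH T (n - 1) (m - 1)) z w z η +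
      (ker T (K₁.map (rev T)) z w z η + ker T ((zShift T K₂).map (rev T)) z w z η) := by
    -- The reflections of 𝓟_{n-1,m} and its subspaces are z-shifts, and a z-shift does not change
    -- the kernel when both z-arguments are the same point of 𝕋. In particular K₂ and zK₂ have
    -- reflections with equal kernels there.
    have h3 := ker_zShift T z w z η (le_refl (polyH T (n - 1) m))
    rw [hz1, one_mul] at h3
    have h4 := ker_zShift T z w z η (polyH_mono T (le_refl ((n : ℤ) - 1))
      (show (m : ℤ) - 1 ≤ m by omega))
    rw [hz1, one_mul] at h4
    have h5 := ker_zShift T z w z η (map_rev_zShift_le (K := K₂))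
    rw [hz1, one_mul, zShift_map_rev_zShift h.le_polyH₂] at h5
    rw [← h3, ← map_rev_polyH, ← wSpace_sup_E1 T hn, Submodule.map_sup,
      ker_sup T (rev_ortho (wSpace_ortho_E1 T hn)), map_rev_wSpace_sub, h4, ← h.sup_eq,
      Submodule.map_sup, ker_sup T (rev_ortho h.ortho), h5]
  rw [h1, h2]
  ring

end

/-! ### No zeros on 𝕋 × closed disk -/

theorem norm_C_X_mul {T : PositiveForm n m} {f g : HT T} (h : toPoly T g = C X * toPoly T f) :
    ‖g‖ = ‖f‖ := by
  rw [← mono_one_zero] at h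
  rw [norm_eq_sqrt_re_inner (𝕜 := ℂ), inner_mono_mul 1 0 h h, ← norm_eq_sqrt_re_inner]

theorem inner_C_X_mul {T : PositiveForm n m} {f g f' g' : HT T}
    (hf : toPoly T f' = C X * toPoly T f) (hg : toPoly T g' = C X * toPoly T g) :
    inner ℂ f' g' = inner ℂ f g := by
  rw [← mono_one_zero] at hf hg
  exact inner_mono_mul 1 0 hg hf

/-- Multiplication by `z`, from `𝓟_{n-1,m}` to `𝓗_T`. -/
def zMul (T : PositiveForm n m) : polyH T (n - 1) m →ₗ[ℂ] HT T where
  toFun f := ofPoly T (C X * toPoly T f) (C_X_mul_mem f.2)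
  map_add' f g := toPoly_injective T (by simp [mul_add])
  map_smul' a f := toPoly_injective T (by simp)

theorem toPoly_zMul (T : PositiveForm n m) (f : polyH T (n - 1) m) :
    toPoly T (zMul T f) = C X * toPoly T f := rfl

/-- Write Z for the variable and z for the fixed point. If f = (Z - z) h is orthogonal to h,
Pythagoras applied to Zh = f + z h gives ‖h‖² = ‖f‖² + ‖h‖², since |z| = 1; hence f = 0. -/
theorem zMul_sub_mem_orthogonal {T : PositiveForm n m} {z : ℂ} (hz : ‖z‖ = 1)
    {h : polyH T (n - 1) m} (hh : zMul T h - z • (h : HT T) ∈ (polyH T (n - 1) m)ᗮ) : h = 0 := by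
  set f := zMul T h - z • (h : HT T) with hf
  have h1 : zMul T h = f + z • (h : HT T) := by rw [hf]; abel
  have h2 : inner ℂ f (z • (h : HT T)) = 0 :=
    (Submodule.mem_orthogonal' _ _).1 hh _ (Submodule.smul_mem _ _ h.2)
  have h3 := norm_add_sq_eq_norm_sq_add_norm_sq_of_inner_eq_zero f (z • (h : HT T)) h2
  rw [← h1, norm_C_X_mul (toPoly_zMul T h), norm_smul, hz, one_mul] at h3
  have h4 : f = 0 := by
    rw [← norm_eq_zero]
    nlinarith [norm_nonneg f]
  have h5 : (C X - C (C z)) * toPoly T h = 0 := by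
    have := congrArg (toPoly T) (hf.symm.trans h4)
    rw [map_sub, map_smul, toPoly_zMul, map_zero] at this
    rw [sub_mul, ← this]
    congr 1
    ext t s
    simp
  have h6 : (C X - C (C z) : ℂ[X][Y]) ≠ 0 := by
    rw [← C_sub]
    exact C_ne_zero.2 (X_sub_C_ne_zero z)
  exact Subtype.ext (toPoly_injective T ((mul_eq_zero.1 h5).resolve_left h6))

/-- With Z the variable, the vector is 1 - (Z - z) h, of value 1 at the point, with h in 𝓟_{n-1,m}
chosen to make it orthogonal to 𝓟_{n-1,m}. Such h exists: the compression of Z - z to 𝓟_{n-1,m} is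
injective, hence surjective in finite dimension. -/
theorem exists_evalH_eq_one (T : PositiveForm n m) {z : ℂ} (hz : ‖z‖ = 1) (w : ℂ) :
    ∃ f ∈ (polyH T (n - 1) m)ᗮ, evalH T z w f = 1 := by
  set A := polyH T (n - 1) m with hA
  let B : A →ₗ[ℂ] HT T := zMul T - z • A.subtype
  let L : A →ₗ[ℂ] A := A.orthogonalProjectionOnto.toLinearMap ∘ₗ B
  have hL : Function.Injective L := by
    rw [← LinearMap.ker_eq_bot, LinearMap.ker_eq_bot']
    intro h hh
    exact zMul_sub_mem_orthogonal hz (Submodule.orthogonalProjectionOnto_eq_zero_iff.1 hh)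
  obtain ⟨h, hh⟩ := LinearMap.injective_iff_surjective.1 hL
    (A.orthogonalProjectionOnto (monoH T 0 0 (Nat.zero_le _) (Nat.zero_le _)))
  refine ⟨monoH T 0 0 (Nat.zero_le _) (Nat.zero_le _) - B h, ?_, ?_⟩
  · rw [← Submodule.orthogonalProjectionOnto_eq_zero_iff, map_sub, sub_eq_zero]
    exact hh.symm
  · have h1 : evalH T z w (B h) = 0 := by
      change evalH T z w (zMul T h - z • (h : HT T)) = 0
      rw [map_sub, map_smul, evalH_apply, toPoly_zMul, evalH_apply]
      simp [evalEval]
    rw [map_sub, h1, sub_zero, evalH_apply]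
    change (mono 0 0).evalEval z w = 1
    simp [mono, evalEval]

/-- The difference is the diagonal kernel of the complement of 𝓟_{n-1,m}, where evaluation does not
vanish. -/
theorem ker_top_sub_pos (T : PositiveForm n m) {z : ℂ} (hz : ‖z‖ = 1) (w : ℂ) :
    ∃ d : ℝ, 0 < d ∧ ker T ⊤ z w z w - ker T (polyH T (n - 1) m) z w z w = d := by
  set A := polyH T (n - 1) m with hA
  have h1 : ker T ⊤ z w z w = ker T A z w z w + ker T Aᗮ z w z w := by
    rw [← ker_sup T (Submodule.isOrtho_orthogonal_right A),
      Submodule.sup_orthogonal_of_hasOrthogonalProjection]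
  refine ⟨‖kern T Aᗮ z w‖ ^ 2, ?_, ?_⟩
  · obtain ⟨f, hf, hfe⟩ := exists_evalH_eq_one T hz w
    have h2 := norm_evalH_le T z w hf
    rw [hfe, norm_one] at h2
    refine pow_pos (lt_of_le_of_ne (norm_nonneg _) fun h0 => ?_) 2
    rw [← h0] at h2
    linarith
  · rw [h1, ← ker_self]
    ring

theorem mul_conj_eq (a : ℂ) : a * starRingEnd ℂ a = ((‖a‖ ^ 2 : ℝ) : ℂ) := by
  rw [Complex.mul_conj, Complex.normSq_eq_norm_sq]

section

variable {T : PositiveForm n m} {K₁ K₂ : Submodule ℂ (HT T)}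

/-- A zero of p at (z,w) removes the p-term from the first kernel identity. Playing it against the
reflected identity makes the strictly positive Δ_m(w,w) vanish. -/
theorem IsShiftSplit.evalH_ne_zero (h : IsShiftSplit T K₁ K₂) {p : HT T}
    (hp : p ∈ E1 T n m ⊓ (K₁ ⊔ zShift T K₂)ᗮ) (hp1 : ‖p‖ = 1) {z w : ℂ} (hz : ‖z‖ = 1)
    (hw : ‖w‖ ≤ 1) : evalH T z w p ≠ 0 := by
  intro h0
  set Q := toPoly T (kern T (polyH T n (m - 1)) z w) -
    toPoly T (kern T (polyH T (n - 1) (m - 1)) z w) with hQ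
  have hδ : ∀ η, ker T (polyH T n (m - 1)) z η z w - ker T (polyH T (n - 1) (m - 1)) z η z w =
      (Q.map (evalRingHom z)).eval η := by
    intro η
    rw [map_evalRingHom_eval, hQ, ker, ker, evalH_apply, evalH_apply]
    simp [evalEval]
  have h1 : ∀ η, _ := fun η => h.ker_sub hp hp1 hz η w
  have h2 : ∀ η, _ := fun η => h.ker_sub_rev hp hp1 hz η w
  simp only [hδ, h0, map_zero, mul_zero, add_zero] at h1 h2
  obtain ⟨d, hd, hD⟩ := ker_top_sub_pos T hz w
  have h1w := h1 w
  have h2w := h2 w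
  rw [hD, mul_conj_eq] at h1w h2w
  set r := ‖evalH T z w (rev T p)‖ with hr
  -- On the diagonal the identities read d = |w|² Q(w) and d = Q(w) + r². As d > 0 and |w| ≤ 1, this
  -- forces |w| = 1 and r = 0.
  have h3 : ‖w‖ ^ 2 * (d - r ^ 2) = d := by
    have : (Q.map (evalRingHom z)).eval w = ((d - r ^ 2 : ℝ) : ℂ) := by
      rw [Complex.ofReal_sub, h2w]
      ring
    rw [this] at h1w
    exact_mod_cast h1w.symm
  have h4 : ‖w‖ ^ 2 ≤ 1 := pow_le_one₀ (norm_nonneg w) hw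
  have h5 : ‖w‖ ^ 2 = 1 := by nlinarith [sq_nonneg r, sq_nonneg ‖w‖, mul_nonneg (sq_nonneg ‖w‖) (sq_nonneg r)]
  have h6 : r = 0 := by
    rw [h5] at h3
    exact pow_eq_zero_iff two_ne_zero |>.1 (by linarith)
  have h7 : evalH T z w (rev T p) = 0 := norm_eq_zero.1 h6
  simp only [h7, map_zero, mul_zero, add_zero] at h2
  -- With both remainder terms gone, Q(η) = η w̄ Q(η) for every η, so Q(z,·) = 0 and then d = 0.
  have h8 : (1 - C (starRingEnd ℂ w) * X) * Q.map (evalRingHom z) = 0 := by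
    refine Polynomial.funext fun η => ?_
    have := (h2 η).symm.trans (h1 η)
    simp only [eval_mul, eval_sub, eval_one, eval_C, eval_X, eval_zero]
    linear_combination this
  have h9 : (1 - C (starRingEnd ℂ w) * X : ℂ[X]) ≠ 0 := fun h => by
    simpa using congrArg (eval 0) h
  rw [(mul_eq_zero.1 h8).resolve_left h9, eval_zero, h6] at h2w
  simp at h2w
  exact hd.ne' h2w

/-- The other terms of `IsShiftSplit.ker_sub` depend on the form only. -/
theorem evalH_mul_conj_eq (h : IsShiftSplit T K₁ K₂) {p : HT T}
    (hp : p ∈ E1 T n m ⊓ (K₁ ⊔ zShift T K₂)ᗮ) (hp1 : ‖p‖ = 1) {K₁' K₂' : Submodule ℂ (HT T)}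
    (h' : IsShiftSplit T K₁' K₂') {p' : HT T} (hp' : p' ∈ E1 T n m ⊓ (K₁' ⊔ zShift T K₂')ᗮ)
    (hp1' : ‖p'‖ = 1) {z : ℂ} (hz : ‖z‖ = 1) (w η : ℂ) :
    evalH T z w p * starRingEnd ℂ (evalH T z η p) =
      evalH T z w p' * starRingEnd ℂ (evalH T z η p') := by
  have h1 := h.ker_sub hp hp1 hz w η
  rw [h'.ker_sub hp' hp1' hz w η] at h1
  exact (add_left_cancel h1).symm

end

/-! ### Comparison of two split-polys -/

theorem infinite_circle : {z : ℂ | ‖z‖ = 1}.Infinite := by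
  have : {z : ℂ | ‖z‖ = 1} = Metric.sphere (0 : ℂ) 1 := by ext; simp
  rw [this]
  refine (IsPreconnected.infinite_of_nontrivial ?_ ⟨1, by simp, -1, by simp, by norm_num⟩)
  exact isPreconnected_sphere (by simp) 0 1

theorem eq_of_eval_eq_circle {f g : ℂ[X]} (h : ∀ z : ℂ, ‖z‖ = 1 → f.eval z = g.eval z) : f = g :=
  eq_of_infinite_eval_eq f g (infinite_circle.mono h)

theorem eq_of_evalEval_eq_circle {f g : ℂ[X][Y]}
    (h : ∀ z w : ℂ, ‖z‖ = 1 → f.evalEval z w = g.evalEval z w) : f = g := by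
  ext1 t
  refine eq_of_eval_eq_circle fun z hz => ?_
  have : f.map (evalRingHom z) = g.map (evalRingHom z) := Polynomial.funext fun w => by
    rw [map_evalRingHom_eval, map_evalRingHom_eval, h z w hz]
  simpa using congrArg (fun q => q.coeff t) this

/-- A split-poly has no zeros on `𝕋 × closed disk`. -/
theorem IsSplitPoly.noZerosTD {T : PositiveForm n m} {p : ℂ[X][Y]} (hp : IsSplitPoly T p) :
    NoZerosTD p := by
  obtain ⟨K₁, K₂, h, f, rfl, hf, hf1⟩ := hp
  exact fun z w hz hw => h.evalH_ne_zero hf hf1 hz hw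

theorem IsSplitPoly.mem_polySpace {T : PositiveForm n m} {p : ℂ[X][Y]} (hp : IsSplitPoly T p) :
    p ∈ polySpace n m := by
  obtain ⟨K₁, K₂, h, f, rfl, hf, hf1⟩ := hp
  exact toPoly_mem T f

theorem evalEval_zero_right (p : ℂ[X][Y]) (z : ℂ) : p.evalEval z 0 = (p.coeff 0).eval z := by
  rw [evalEval, C_0, ← coeff_zero_eq_eval_zero]

theorem NoZerosTD.eval_coeff_zero_ne {p : ℂ[X][Y]} (hp : NoZerosTD p) {z : ℂ} (hz : ‖z‖ = 1) :
    (p.coeff 0).eval z ≠ 0 := by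
  rw [← evalEval_zero_right]
  exact hp z 0 hz (by simp)

theorem IsSplitPoly.mul_conj_eq {T : PositiveForm n m} {p p' : ℂ[X][Y]} (hp : IsSplitPoly T p)
    (hp' : IsSplitPoly T p') {z : ℂ} (hz : ‖z‖ = 1) (w η : ℂ) :
    p.evalEval z w * starRingEnd ℂ (p.evalEval z η) =
      p'.evalEval z w * starRingEnd ℂ (p'.evalEval z η) := by
  obtain ⟨K₁, K₂, h, f, rfl, hf, hf1⟩ := hp
  obtain ⟨K₁', K₂', h', f', rfl, hf', hf1'⟩ := hp'
  exact evalH_mul_conj_eq h hf hf1 h' hf' hf1' hz w η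

/-- Any two split-polys are proportional over `ℂ(z)`. -/
theorem IsSplitPoly.C_mul_eq {T : PositiveForm n m} {p p' : ℂ[X][Y]} (hp : IsSplitPoly T p)
    (hp' : IsSplitPoly T p') : C (p.coeff 0) * p' = C (p'.coeff 0) * p := by
  refine eq_of_evalEval_eq_circle fun z w hz => ?_
  have h1 := hp.mul_conj_eq hp' hz w 0
  have h2 := hp.mul_conj_eq hp' hz 0 0
  simp only [evalEval_zero_right] at h1 h2
  have h3 : starRingEnd ℂ ((p'.coeff 0).eval z) ≠ 0 := by
    rw [_root_.map_ne_zero]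
    exact hp'.noZerosTD.eval_coeff_zero_ne hz
  rw [evalEval_mul, evalEval_mul, evalEval_C, evalEval_C]
  apply mul_right_cancel₀ h3
  -- Both identities have η = 0; cross-multiplying eliminates the conjugated value of p(z,0), and
  -- that of p'(z,0) is the nonzero factor being cancelled.
  linear_combination (-(p.coeff 0).eval z) * h1 + p.evalEval z w * h2

theorem IsSplitPoly.norm_eq {T : PositiveForm n m} {p p' : ℂ[X][Y]} (hp : IsSplitPoly T p)
    (hp' : IsSplitPoly T p') {z : ℂ} (hz : ‖z‖ = 1) :
    ‖(p.coeff 0).eval z‖ = ‖(p'.coeff 0).eval z‖ := by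
  have h := hp.mul_conj_eq hp' hz 0 0
  rw [SplitShift.mul_conj_eq, SplitShift.mul_conj_eq, evalEval_zero_right,
    evalEval_zero_right] at h
  exact (sq_eq_sq₀ (norm_nonneg _) (norm_nonneg _)).1 (by exact_mod_cast h)

/-! ### Recovering a shift-split from a trace -/

open Filter Topology in
-- The bound makes f vanish at each zero of b. Cancelling the common linear factor preserves the
-- bound away from that zero, and at the zero by continuity, so induction on the degree counts
-- multiplicities.
theorem dvd_of_norm_le {S : Set ℂ} (hS : IsOpen S) {φ : ℂ → ℝ} (hφ : Continuous φ)
    (hφ0 : ∀ z ∈ S, 0 < φ z) (M : ℝ) (a : ℂ[X]) {b f : ℂ[X]} (hb : b ≠ 0)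
    (hbS : ∀ z, b.eval z = 0 → z ∈ S)
    (h : ∀ z ∈ S, ‖f.eval z‖ ^ 2 * φ z ≤ M * ‖(a * b).eval z‖ ^ 2) : b ∣ f := by
  induction hd : b.natDegree generalizing b f with
  | zero =>
    rw [eq_C_of_natDegree_eq_zero hd] at hb ⊢
    exact (isUnit_C.2 (isUnit_iff_ne_zero.2 (C_ne_zero.1 hb))).dvd
  | succ d ih =>
    obtain ⟨α, hα⟩ := IsAlgClosed.exists_root b (by
      rw [degree_eq_natDegree hb, hd]
      exact_mod_cast Nat.succ_ne_zero d)
    have hαS := hbS α hα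
    obtain ⟨b', rfl⟩ := dvd_iff_isRoot.2 hα
    have hfα : f.eval α = 0 := by
      have h1 := h α hαS
      simp only [eval_mul, eval_sub, eval_X, eval_C, sub_self, zero_mul, mul_zero, norm_zero,
        ne_eq, OfNat.ofNat_ne_zero, not_false_eq_true, zero_pow] at h1
      have h2 := hφ0 α hαS
      have h3 : ‖f.eval α‖ ^ 2 ≤ 0 := by
        by_contra! h4
        exact absurd (mul_pos h4 h2) (not_lt.2 h1)
      exact norm_eq_zero.1 (pow_eq_zero_iff two_ne_zero |>.1 (le_antisymm h3 (sq_nonneg _)))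
    obtain ⟨f', rfl⟩ := dvd_iff_isRoot.2 hfα
    have hb' : b' ≠ 0 := right_ne_zero_of_mul hb
    refine mul_dvd_mul_left _ (ih hb' (fun z hz => hbS z (by simp [hz])) ?_ ?_)
    · have hne : ∀ z ∈ S, z ≠ α →
          ‖f'.eval z‖ ^ 2 * φ z ≤ M * ‖(a * b').eval z‖ ^ 2 := by
        intro z hz hzα
        have h1 := h z hz
        simp only [eval_mul, eval_sub, eval_X, eval_C, norm_mul, mul_pow] at h1 ⊢
        have h2 : 0 < ‖z - α‖ ^ 2 := pow_pos (norm_pos_iff.2 (sub_ne_zero.2 hzα)) 2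
        refine le_of_mul_le_mul_left ?_ h2
        linarith
      intro z hz
      by_cases hzα : z = α
      · subst hzα
        refine le_of_tendsto_of_tendsto (b := 𝓝[≠] z)
          (f := fun z => ‖f'.eval z‖ ^ 2 * φ z) (g := fun z => M * ‖(a * b').eval z‖ ^ 2)
          ?_ ?_ ?_
        · exact ((f'.continuous.norm.pow 2).mul hφ).continuousAt.mono_left nhdsWithin_le_nhds
        · exact (continuous_const.mul ((a * b').continuous.norm.pow 2)).continuousAt.mono_left
            nhdsWithin_le_nhds
        · filter_upwards [self_mem_nhdsWithin, mem_nhdsWithin_of_mem_nhds (hS.mem_nhds hz)]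
            with y hy hyS using hne y hyS hy
      · exact hne z hz hzα
    · rw [natDegree_mul (X_sub_C_ne_zero α) hb', natDegree_X_sub_C] at hd
      omega

open Filter Topology in
-- The quotient is the reflected polynomial evaluated at 1/t, which tends to 0.
theorem tendsto_eval_div_pow (f : ℂ[X]) {N : ℕ} (hN : f.natDegree ≤ N) :
    Tendsto (fun t : ℝ => f.eval (t : ℂ) / (t : ℂ) ^ N) atTop (𝓝 (f.coeff N)) := by
  have h1 : Tendsto (fun t : ℝ => ((t : ℂ))⁻¹) atTop (𝓝 0) := by
    have := (Complex.continuous_ofReal.tendsto 0).comp tendsto_inv_atTop_zero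
    simpa [Function.comp_def] using this
  have h2 := ((f.reflect N).continuous.tendsto 0).comp h1
  rw [← coeff_zero_eq_eval_zero, coeff_reflect, revAt_le (Nat.zero_le _), Nat.sub_zero] at h2
  refine h2.congr' ?_
  filter_upwards [eventually_gt_atTop 0] with t ht
  have ht0 : (t : ℂ) ≠ 0 := by exact_mod_cast ht.ne'
  have : Invertible (t : ℂ) := invertibleOfNonzero ht0
  have h3 := eval₂_reflect_mul_pow (RingHom.id ℂ) (t : ℂ) N f hN
  rw [invOf_eq_inv] at h3
  rw [Function.comp_apply, eq_div_iff (pow_ne_zero _ ht0)]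
  exact h3

open Filter Topology in
-- The factor |z|² - 1 costs one degree. If N = deg f were at least deg P, dividing by t^(2N+2)
-- along z = t → ∞ would bound the squared modulus of the leading coefficient of f by 0.
theorem natDegree_lt_of_norm_le {f P : ℂ[X]} (hf : f ≠ 0) (M : ℝ)
    (h : ∀ z : ℂ, 1 < ‖z‖ → ‖f.eval z‖ ^ 2 * (‖z‖ ^ 2 - 1) ≤ M * ‖P.eval z‖ ^ 2) :
    f.natDegree < P.natDegree := by
  by_contra! hN
  set N := f.natDegree
  have h1 : Tendsto (fun t : ℝ => ‖f.eval (t : ℂ) / (t : ℂ) ^ N‖ ^ 2 * (1 - (t⁻¹) ^ 2)) atTop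
      (𝓝 (‖f.coeff N‖ ^ 2 * (1 - 0 ^ 2))) :=
    ((tendsto_eval_div_pow f le_rfl).norm.pow 2).mul
      (tendsto_const_nhds.sub (tendsto_inv_atTop_zero.pow 2))
  have h2 : Tendsto (fun t : ℝ => M * ‖P.eval (t : ℂ) / (t : ℂ) ^ N‖ ^ 2 * (t⁻¹) ^ 2) atTop
      (𝓝 (M * ‖P.coeff N‖ ^ 2 * 0 ^ 2)) :=
    (tendsto_const_nhds.mul ((tendsto_eval_div_pow P hN).norm.pow 2)).mul
      (tendsto_inv_atTop_zero.pow 2)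
  have h3 := le_of_tendsto_of_tendsto h1 h2 (by
    filter_upwards [eventually_gt_atTop 1] with t ht
    have ht0 : 0 < t := by linarith
    have h4 := h (t : ℂ) (by simpa [abs_of_pos ht0] using ht)
    simp only [norm_div, norm_pow, Complex.norm_real, Real.norm_eq_abs, abs_of_pos ht0] at h4 ⊢
    have h5 : 0 ≤ (t ^ N)⁻¹ ^ 2 * (t⁻¹) ^ 2 := by positivity
    have h6 := mul_le_mul_of_nonneg_right h4 h5
    calc _ = ‖f.eval (t : ℂ)‖ ^ 2 * (t ^ 2 - 1) * ((t ^ N)⁻¹ ^ 2 * (t⁻¹) ^ 2) := by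
          field_simp
      _ ≤ _ := h6
      _ = _ := by field_simp)
  have h4 : 0 < ‖f.coeff N‖ ^ 2 :=
    pow_pos (norm_pos_iff.2 (leadingCoeff_ne_zero.2 hf)) 2
  simp only [ne_eq, OfNat.ofNat_ne_zero, not_false_eq_true, zero_pow, sub_zero, mul_one,
    mul_zero] at h3
  exact absurd h4 (not_lt.2 h3)

section

variable {T : PositiveForm n m} {K₁ K₂ : Submodule ℂ (HT T)}

/-- At w = 0, 𝓗_T has diagonal kernel k₁ + |z|² k₂ + |p(z,0)|² and 𝓟_{n-1,m} has k₁ + k₂. The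
inclusion z𝓟_{n-1,m} ⊆ 𝓗_T gives the first bound and 𝓟_{n-1,m} ⊆ 𝓗_T the second. -/
theorem IsShiftSplit.kern_bounds (h : IsShiftSplit T K₁ K₂) {p : HT T}
    (hp : p ∈ E1 T n m ⊓ (K₁ ⊔ zShift T K₂)ᗮ) (hp1 : ‖p‖ = 1) (z : ℂ) :
    ‖kern T K₁ z 0‖ ^ 2 * (‖z‖ ^ 2 - 1) ≤ ‖(trace T p).eval z‖ ^ 2 ∧
    ‖kern T K₂ z 0‖ ^ 2 * (1 - ‖z‖ ^ 2) ≤ ‖(trace T p).eval z‖ ^ 2 := by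
  have h1 := h.ker_top hp hp1 z 0 z 0
  have h2 := h.ker_polyH z 0 z 0
  have h3 := ker_zShift T z 0 z 0 (le_refl (polyH T (n - 1) m))
  generalize polyH T (n - 1) m = A at h2 h3
  rw [zero_mul, zero_mul, zero_add, mul_conj_eq, mul_conj_eq, evalH_zero_right] at h1
  rw [zero_mul, zero_mul, zero_add] at h2
  rw [mul_conj_eq] at h3
  simp only [ker_self] at h1 h2 h3
  norm_cast at h1 h2 h3
  have h4 := pow_le_pow_left₀ (norm_nonneg _)
    (kern_norm_mono T (le_top : zShift T A ≤ ⊤) z 0) 2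
  have h5 := pow_le_pow_left₀ (norm_nonneg _)
    (kern_norm_mono T (le_top : A ≤ ⊤) z 0) 2
  rw [h3, h2, h1] at h4
  rw [h2, h1] at h5
  constructor <;> linarith

theorem norm_trace_sq_le {V : Submodule ℂ (HT T)} {f : HT T} (hf : f ∈ V) {z : ℂ} {c B : ℝ}
    (hc : 0 ≤ c) (h : ‖kern T V z 0‖ ^ 2 * c ≤ B) : ‖(trace T f).eval z‖ ^ 2 * c ≤ ‖f‖ ^ 2 * B := by
  have h1 := pow_le_pow_left₀ (norm_nonneg _) (norm_evalH_le T z 0 hf) 2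
  rw [evalH_zero_right, mul_pow] at h1
  calc _ ≤ ‖kern T V z 0‖ ^ 2 * ‖f‖ ^ 2 * c := mul_le_mul_of_nonneg_right h1 hc
    _ = ‖f‖ ^ 2 * (‖kern T V z 0‖ ^ 2 * c) := by ring
    _ ≤ _ := mul_le_mul_of_nonneg_left h (sq_nonneg _)

/-- Projection to 𝓔¹_{n-1,m} preserves traces, so f and the combination of projected z^j a with the
coefficients of r agree at w = 0, hence agree. The degree hypothesis puts each z^j a in 𝓟_{n-1,m}.
-/
theorem mem_projSpan {a r : ℂ[X]} {N : ℕ} (ha : a.natDegree + N ≤ n) (hr : r ∈ degreeLT ℂ N)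
    {f : HT T} (hf : f ∈ E1 T (n - 1) m) (h : trace T f = r * a) : f ∈ projSpan T a N := by
  have hn : (n : ℤ) - 1 ≤ n := by omega
  have hF : ∀ j : ℕ, j < N → ∃ F ∈ polyH T (n - 1) m, toPoly T F = C (X ^ j * a) ∧
      trace T F = X ^ j * a := by
    intro j hj
    refine exists_trace_eq T hn fun s hs => ?_
    have h1 := le_natDegree_of_ne_zero hs
    have h2 : (X ^ j * a).natDegree ≤ j + a.natDegree :=
      natDegree_mul_le.trans (by simp)
    omega
  choose! F hF1 hF2 hF3 using hF
  have key : f = ∑ j ∈ Finset.range N,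
      r.coeff j • (E1 T (n - 1) m).starProjection (F j) := by
    refine eq_of_trace_eq hn hf (Submodule.sum_mem _ fun j _ => Submodule.smul_mem _ _
      (Submodule.starProjection_apply_mem _ _)) ?_
    have hr' : r = ∑ j ∈ Finset.range N, r.coeff j • X ^ j := by
      by_cases h0 : r = 0
      · simp [h0]
      · rw [mem_degreeLT, degree_eq_natDegree h0] at hr
        conv_lhs => rw [as_sum_range' r N (by exact_mod_cast hr)]
        exact Finset.sum_congr rfl fun j _ => by rw [smul_X_eq_monomial]
    rw [h, map_sum]
    conv_lhs => rw [hr', Finset.sum_mul]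
    refine Finset.sum_congr rfl fun j hj => ?_
    rw [Finset.mem_range] at hj
    rw [map_smul, trace_starProjection T hn (hF1 j hj), hF3 j hj, smul_mul_assoc]
  rw [key]
  refine Submodule.sum_mem _ fun j hj => Submodule.smul_mem _ _ (Submodule.subset_span ?_)
  rw [Finset.mem_range] at hj
  exact ⟨F j, ⟨j, hj, hF2 j hj⟩, rfl⟩

theorem finrank_projSpan_le (a : ℂ[X]) (N : ℕ) : Module.finrank ℂ (projSpan T a N) ≤ N := by
  classical
  let b : Fin N → HT T := fun j =>
    -- There is no degree hypothesis here: z^j a may lie outside 𝓗_T, in which case it contributes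
    -- no generator and 0 fills its place.
    if h : ∃ f : HT T, toPoly T f = C (X ^ (j : ℕ) * a) then
      (E1 T (n - 1) m).starProjection h.choose else 0
  have h1 : projSpan T a N ≤ Submodule.span ℂ (Set.range b) := by
    refine Submodule.span_mono ?_
    rintro _ ⟨f, ⟨j, hj, hf⟩, rfl⟩
    have hex : ∃ f : HT T, toPoly T f = C (X ^ j * a) := ⟨f, hf⟩
    refine ⟨⟨j, hj⟩, ?_⟩
    change (if h : ∃ f : HT T, toPoly T f = C (X ^ j * a) then
      (E1 T (n - 1) m).starProjection h.choose else 0) = _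
    rw [dif_pos hex]
    congr 1
    exact toPoly_injective T (hex.choose_spec.trans hf.symm)
  refine (Submodule.finrank_mono h1).trans ?_
  have := finrank_range_le_card (R := ℂ) b
  rwa [Fintype.card_fin] at this

theorem trace_natDegree_le (p : HT T) : (trace T p).natDegree ≤ n := by
  by_contra! h
  have h0 : trace T p ≠ 0 := by
    rintro h0
    simp [h0] at h
  have := trace_coeff (polyH_top T ▸ Submodule.mem_top : p ∈ polyH T n m) _
    (leadingCoeff_ne_zero.2 h0 : (trace T p).coeff _ ≠ 0)
  omega

/-- A shift-split is determined by the restriction of a split-poly to `w = 0`. -/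
theorem IsShiftSplit.eq_projSpan (h : IsShiftSplit T K₁ K₂) {p : HT T}
    (hp : p ∈ E1 T n m ⊓ (K₁ ⊔ zShift T K₂)ᗮ) (hp1 : ‖p‖ = 1) {a b : ℂ[X]}
    (hab : trace T p = a * b) (ha : Stable a) (hb : AllZerosInDisk b) :
    K₁ = projSpan T a b.natDegree ∧ K₂ = projSpan T b (n - b.natDegree) := by
  have hn : (n : ℤ) - 1 ≤ n := by omega
  have ha0 : a ≠ 0 := by rintro rfl; exact ha 0 (by simp) (by simp)
  have hb0 : b ≠ 0 := by rintro rfl; simpa using hb 1 (by simp)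
  have hdeg : a.natDegree + b.natDegree ≤ n := by
    rw [← natDegree_mul ha0 hb0, ← hab]
    exact trace_natDegree_le p
  have hK₁ : K₁ ≤ projSpan T a b.natDegree := by
    intro f hf
    have hfE : f ∈ E1 T (n - 1) m := h.sup_eq ▸ Submodule.mem_sup_left hf
    have hbd : ∀ z : ℂ, 1 < ‖z‖ →
        ‖(trace T f).eval z‖ ^ 2 * (‖z‖ ^ 2 - 1) ≤ ‖f‖ ^ 2 * ‖(b * a).eval z‖ ^ 2 := by
      intro z hz
      rw [mul_comm b, ← hab]
      exact norm_trace_sq_le hf (by nlinarith) (h.kern_bounds hp hp1 z).1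
    -- All zeros of a lie outside the closed disk, where the K₁ bound is effective. Its growth at
    -- infinity later gives deg r < deg b.
    obtain ⟨r, hr⟩ := dvd_of_norm_le (S := {z | 1 < ‖z‖})
      (isOpen_lt continuous_const continuous_norm) (φ := fun z => ‖z‖ ^ 2 - 1)
      (by fun_prop) (fun z (hz : 1 < ‖z‖) => by nlinarith) _ b ha0
      (fun z hz => by
        by_contra h1
        exact ha z (not_lt.1 h1) hz) hbd
    refine mem_projSpan hdeg ?_ hfE (hr.trans (mul_comm a r))
    rw [mem_degreeLT]
    by_cases hr0 : r = 0
    · simp [hr0]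
    · have := natDegree_lt_of_norm_le (by rw [hr]; exact mul_ne_zero ha0 hr0) _ hbd
      rw [hr, natDegree_mul ha0 hr0, natDegree_mul hb0 ha0] at this
      rw [degree_eq_natDegree hr0]
      exact_mod_cast (by omega : r.natDegree < b.natDegree)
  have hK₂ : K₂ ≤ projSpan T b (n - b.natDegree) := by
    intro f hf
    have hfE : f ∈ E1 T (n - 1) m := h.sup_eq ▸ Submodule.mem_sup_right hf
    have hbd : ∀ z : ℂ, ‖z‖ < 1 →
        ‖(trace T f).eval z‖ ^ 2 * (1 - ‖z‖ ^ 2) ≤ ‖f‖ ^ 2 * ‖(a * b).eval z‖ ^ 2 := by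
      intro z hz
      rw [← hab]
      exact norm_trace_sq_le hf (by nlinarith [norm_nonneg z]) (h.kern_bounds hp hp1 z).2
    obtain ⟨r, hr⟩ := dvd_of_norm_le (S := {z | ‖z‖ < 1})
      (isOpen_lt continuous_norm continuous_const) (φ := fun z => 1 - ‖z‖ ^ 2)
      (by fun_prop) (fun z (hz : ‖z‖ < 1) => by nlinarith [norm_nonneg z]) _ a hb0
      (fun z hz => hb z hz) hbd
    refine mem_projSpan (by omega) ?_ hfE (hr.trans (mul_comm b r))
    rw [mem_degreeLT]
    by_cases hr0 : r = 0
    · simp [hr0]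
    · have hr1 : trace T f ≠ 0 := by rw [hr]; exact mul_ne_zero hb0 hr0
      -- For K₂ the degree bound is just membership in 𝓟_{n-1,m}; no growth argument is needed.
      have := trace_coeff (E1_le_polyH T _ hfE) _
        (leadingCoeff_ne_zero.2 hr1 : (trace T f).coeff _ ≠ 0)
      rw [hr, natDegree_mul hb0 hr0] at this
      rw [degree_eq_natDegree hr0]
      exact_mod_cast (by omega : r.natDegree < n - b.natDegree)
  -- The dimensions of K₁ and K₂ add up to n, and so do the upper bounds deg b and n - deg b; both
  -- inclusions must be equalities.
  have h1 := h.finrank_add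
  have h2 := finrank_projSpan_le (T := T) a b.natDegree
  have h3 := finrank_projSpan_le (T := T) b (n - b.natDegree)
  have h4 := Submodule.finrank_mono hK₁
  have h5 := Submodule.finrank_mono hK₂
  exact ⟨Submodule.eq_of_le_of_finrank_le hK₁ (by omega),
    Submodule.eq_of_le_of_finrank_le hK₂ (by omega)⟩

end

/-! ### One-variable polynomials: stability and reflection -/

theorem Stable.mul {a b : ℂ[X]} (ha : Stable a) (hb : Stable b) : Stable (a * b) := fun z hz => by
  rw [eval_mul]
  exact mul_ne_zero (ha z hz) (hb z hz)

theorem AllZerosInDisk.mul {a b : ℂ[X]} (ha : AllZerosInDisk a) (hb : AllZerosInDisk b) :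
    AllZerosInDisk (a * b) := fun z hz => by
  rw [eval_mul] at hz
  exact (mul_eq_zero.1 hz).elim (ha z) (hb z)

theorem Stable.ne_zero {a : ℂ[X]} (ha : Stable a) : a ≠ 0 := by
  rintro rfl
  exact ha 0 (by simp) (by simp)

theorem AllZerosInDisk.ne_zero {b : ℂ[X]} (hb : AllZerosInDisk b) : b ≠ 0 := by
  rintro rfl
  simpa using hb 1 (by simp)

theorem exists_stable_mul {c : ℂ[X]} (hc : ∀ z : ℂ, ‖z‖ = 1 → c.eval z ≠ 0) :
    ∃ a b : ℂ[X], c = a * b ∧ Stable a ∧ AllZerosInDisk b := by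
  have hc0 : c ≠ 0 := by
    rintro rfl
    exact hc 1 (by simp) (by simp)
  induction hd : c.natDegree generalizing c with
  | zero =>
    refine ⟨c, 1, (mul_one c).symm, fun z _ => ?_, fun z hz => by simp at hz⟩
    rw [eq_C_of_natDegree_eq_zero hd, eval_C]
    rwa [eq_C_of_natDegree_eq_zero hd, C_ne_zero] at hc0
  | succ d ih =>
    obtain ⟨α, hα⟩ := IsAlgClosed.exists_root c (by
      rw [degree_eq_natDegree hc0, hd]
      exact_mod_cast Nat.succ_ne_zero d)
    obtain ⟨c', rfl⟩ := dvd_iff_isRoot.2 hα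
    have hc' := right_ne_zero_of_mul hc0
    obtain ⟨a, b, rfl, ha, hb⟩ := ih (c := c') (fun z hz h0 => hc z hz (by simp [h0])) hc' (by
      rw [natDegree_mul (X_sub_C_ne_zero α) hc', natDegree_X_sub_C] at hd
      omega)
    have h1 : ∀ z, (X - C α).eval z = 0 ↔ z = α := fun z => by simp [sub_eq_zero]
    rcases lt_or_ge ‖α‖ 1 with h | h
    · refine ⟨a, (X - C α) * b, by ring, ha, AllZerosInDisk.mul (fun z hz => ?_) hb⟩
      rwa [(h1 z).1 hz]
    · refine ⟨(X - C α) * a, b, by ring, Stable.mul (fun z hz h0 => ?_) ha, hb⟩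
      rw [(h1 z).1 h0] at hz
      exact hc α (le_antisymm hz h) hα

theorem reflection_mul (a b : ℂ[X]) : reflection (a * b) = reflection a * reflection b := by
  rw [reflection, Polynomial.map_mul, reverse_mul_of_domain]
  rfl

theorem reflection_C (a : ℂ) : reflection (C a) = C (starRingEnd ℂ a) := by
  rw [reflection, map_C, reverse_C]

theorem reflection_X_sub_C (α : ℂ) : reflection (X - C α) = 1 - C (starRingEnd ℂ α) * X := by
  have h : (X - C α).map (starRingEnd ℂ) = X - C (starRingEnd ℂ α) := by simp
  rw [reflection, h, reverse, natDegree_X_sub_C, reflect_sub, reflect_C, pow_one]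
  congr 1
  simp

theorem eval_map_conj (q : ℂ[X]) (z : ℂ) :
    (q.map (starRingEnd ℂ)).eval (starRingEnd ℂ z) = starRingEnd ℂ (q.eval z) := by
  rw [eval_map, eval₂_hom]

/-- `z^{deg q} conj q(1/z̄)` at a nonzero point. -/
theorem eval_reflection (q : ℂ[X]) {z : ℂ} (hz : z ≠ 0) :
    (reflection q).eval z = z ^ q.natDegree * starRingEnd ℂ (q.eval (starRingEnd ℂ z)⁻¹) := by
  have : Invertible (z⁻¹) := invertibleOfNonzero (inv_ne_zero hz)
  have h := eval₂_reverse_mul_pow (RingHom.id ℂ) (z⁻¹) (q.map (starRingEnd ℂ))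
  rw [invOf_eq_inv, inv_inv, natDegree_map] at h
  change (reflection q).eval z * z⁻¹ ^ q.natDegree = (q.map (starRingEnd ℂ)).eval z⁻¹ at h
  rw [← eval_map_conj, map_inv₀, Complex.conj_conj, ← h, inv_pow, mul_comm (z ^ _),
    inv_mul_cancel_right₀ (pow_ne_zero _ hz)]

theorem norm_eval_reflection (q : ℂ[X]) {z : ℂ} (hz : ‖z‖ = 1) :
    ‖(reflection q).eval z‖ = ‖q.eval z‖ := by
  have hz0 : z ≠ 0 := by
    rintro rfl
    simp at hz
  have h : (starRingEnd ℂ z)⁻¹ = z := by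
    rw [← map_inv₀, Complex.inv_eq_conj hz, Complex.conj_conj]
  rw [eval_reflection q hz0, h, norm_mul, norm_pow, hz, one_pow, one_mul, Complex.norm_conj]

theorem AllZerosInDisk.stable_reflection {b : ℂ[X]} (hb : AllZerosInDisk b) :
    Stable (reflection b) := by
  intro z hz h0
  by_cases hz0 : z = 0
  · rw [hz0, ← coeff_zero_eq_eval_zero, reflection, coeff_zero_reverse, leadingCoeff_eq_zero,
      Polynomial.map_eq_zero] at h0
    exact hb.ne_zero h0
  · rw [eval_reflection b hz0, mul_eq_zero] at h0
    have h1 := hb _ ((_root_.map_eq_zero _).1 (h0.resolve_left (pow_ne_zero _ hz0)))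
    rw [norm_inv, Complex.norm_conj] at h1
    exact absurd h1 (not_lt.2 (one_le_inv₀ (norm_pos_iff.2 hz0) |>.2 hz))

theorem allZerosInDisk_of_stable_reflection {b : ℂ[X]} (hb : Stable (reflection b)) :
    AllZerosInDisk b := by
  intro z hz
  by_contra! h
  have hz0 : z ≠ 0 := by
    rintro rfl
    simp at h
    linarith
  have h1 : starRingEnd ℂ z ≠ 0 := (_root_.map_ne_zero _).2 hz0
  refine hb (starRingEnd ℂ z)⁻¹ ?_ ?_
  · rw [norm_inv, Complex.norm_conj]
    exact inv_le_one_of_one_le₀ h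
  · rw [eval_reflection b (inv_ne_zero h1), map_inv₀, inv_inv, Complex.conj_conj, hz, map_zero,
      mul_zero]

/-- A stable polynomial is determined, up to a unimodular constant, by its modulus on the
circle. -/
theorem Stable.eq_of_norm_eq {a b : ℂ[X]} (ha : Stable a) (hb : Stable b)
    (h : ∀ z : ℂ, ‖z‖ = 1 → ‖a.eval z‖ = ‖b.eval z‖) :
    ∃ c : ℂ, ‖c‖ = 1 ∧ a = C c * b := by
  -- On 𝕋 the product of a polynomial and its reflection is z^deg times the squared modulus; the
  -- powers of z equalize the degrees.
  have hpoly : a * reflection a * X ^ b.natDegree = b * reflection b * X ^ a.natDegree := by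
    refine eq_of_eval_eq_circle fun z hz => ?_
    have hz0 : z ≠ 0 := by
      rintro rfl
      simp at hz
    have h1 : (starRingEnd ℂ z)⁻¹ = z := by
      rw [← map_inv₀, Complex.inv_eq_conj hz, Complex.conj_conj]
    have h2 : a.eval z * starRingEnd ℂ (a.eval z) = b.eval z * starRingEnd ℂ (b.eval z) := by
      rw [mul_conj_eq, mul_conj_eq, h z hz]
    simp only [eval_mul, eval_reflection _ hz0, h1, eval_pow, eval_X]
    linear_combination z ^ a.natDegree * z ^ b.natDegree * h2
  have hdvd : ∀ {a b : ℂ[X]}, Stable a → Stable b →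
      a * reflection a * X ^ b.natDegree = b * reflection b * X ^ a.natDegree → a ∣ b := by
    intro a b ha hb hab
    -- Zeros of a lie outside the closed disk, those of the reflection of b and of z inside the open
    -- disk.
    have hcop : IsCoprime a (reflection b * X ^ a.natDegree) := by
      rw [isCoprime_iff_aeval_ne_zero_of_isAlgClosed ℂ ℂ]
      intro z
      simp only [coe_aeval_eq_eval]
      by_contra! h0
      have hz : 1 < ‖z‖ := not_le.1 fun hz => ha z hz h0.1
      have hz0 : z ≠ 0 := norm_pos_iff.1 (by linarith)
      have h1 := h0.2
      rw [eval_mul, eval_reflection b hz0, eval_pow, eval_X, mul_eq_zero, mul_eq_zero,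
        or_iff_left (pow_ne_zero _ hz0), or_iff_right (pow_ne_zero _ hz0),
        _root_.map_eq_zero] at h1
      refine hb _ ?_ h1
      rw [norm_inv, Complex.norm_conj]
      exact inv_le_one_of_one_le₀ hz.le
    refine hcop.dvd_of_dvd_mul_right ⟨reflection a * X ^ b.natDegree, ?_⟩
    rw [← mul_assoc, ← hab]
    ring
  obtain ⟨u, hu⟩ := associated_of_dvd_dvd (hdvd hb ha hpoly.symm) (hdvd ha hb hpoly)
  obtain ⟨c, hc, hcu⟩ := Polynomial.isUnit_iff.1 u.isUnit
  refine ⟨c, ?_, by rw [← hu, ← hcu, mul_comm]⟩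
  have h1 := h 1 (by simp)
  rw [← hu, ← hcu, eval_mul, eval_C, norm_mul] at h1
  have h2 : ‖b.eval 1‖ ≠ 0 := norm_ne_zero_iff.2 (hb 1 (by simp))
  exact mul_left_cancel₀ h2 (by rw [h1, mul_one])

/-! ### Degrees of factors in z -/

theorem natDegree_coeff_le {j k : ℤ} {f : ℂ[X][Y]} (hf : f ∈ polySpace j k) {t : ℕ}
    (ht : f.coeff t ≠ 0) : ((f.coeff t).natDegree : ℤ) ≤ j ∧ (t : ℤ) ≤ k :=
  mem_polySpace_iff.1 hf _ _ (leadingCoeff_ne_zero.2 ht)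

theorem mem_polySpace_of_C_mul {j k : ℤ} {u : ℂ[X]} (hu : u ≠ 0) {h : ℂ[X][Y]}
    (hf : C u * h ∈ polySpace j k) : h ∈ polySpace (j - u.natDegree) k := by
  rw [mem_polySpace_iff]
  intro s t hst
  have ht : h.coeff t ≠ 0 := by
    intro h0
    simp [h0] at hst
  have h1 := natDegree_coeff_le hf (t := t) (by rw [coeff_C_mul]; exact mul_ne_zero hu ht)
  rw [coeff_C_mul, natDegree_mul hu ht] at h1
  have h2 := le_natDegree_of_ne_zero hst
  push_cast at h1
  omega

theorem natDegree_add_degZ_le {c : ℂ[X]} {g : ℂ[X][Y]} (hc : c ≠ 0) (hg : g ≠ 0)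
    (h : C c * g ∈ polySpace n m) : c.natDegree + degZ g ≤ n := by
  obtain ⟨t, ht, h1⟩ := Finset.exists_mem_eq_sup g.support (support_nonempty.2 hg)
    fun k => (g.coeff k).natDegree
  rw [degZ, h1]
  have ht' := mem_support_iff.1 ht
  have h2 := (natDegree_coeff_le (mem_polySpace_of_C_mul hc h) ht').1
  omega

/-! ### Moving zeros of a split-poly across 𝕋 -/

theorem zShift_sup_span_le {T : PositiveForm n m} {K : Submodule ℂ (HT T)} {h zh : HT T}
    (hK : K ≤ polyH T (n - 1) m) (hzh : toPoly T zh = C X * toPoly T h) :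
    zShift T (K ⊔ (ℂ ∙ h)) ≤ zShift T K ⊔ (ℂ ∙ zh) := by
  intro f hf
  obtain ⟨g, hg, hfg⟩ := mem_zShift.1 hf
  obtain ⟨k, hk, x, hx, rfl⟩ := Submodule.mem_sup.1 hg
  obtain ⟨c, rfl⟩ := Submodule.mem_span_singleton.1 hx
  obtain ⟨zk, -, hzk⟩ := exists_C_X_mul le_rfl (hK hk)
  have : f = zk + c • zh := toPoly_injective T (by
    rw [hfg, map_add, map_add, hzk, map_smul, map_smul, hzh, mul_add, mul_smul_comm])
  rw [this]
  exact Submodule.add_mem_sup (mem_zShift.2 ⟨k, hk, hzk⟩)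
    (Submodule.smul_mem _ _ (Submodule.mem_span_singleton_self zh))

section

variable {T : PositiveForm n m} {K₁ K₂ : Submodule ℂ (HT T)}

/-- If `(z - α) h` is a split-poly associated to `(K₁, K₂)` and `|α| < 1`, then `h ∈ K₁`. -/
theorem IsShiftSplit.mem_of_X_sub_C_mul (hs : IsShiftSplit T K₁ K₂) {p : HT T}
    (hp : p ∈ E1 T n m ⊓ (K₁ ⊔ zShift T K₂)ᗮ) (hp1 : ‖p‖ = 1) {α : ℂ} (hα : ‖α‖ < 1)
    {h zh : HT T} (hh : h ∈ polyH T (n - 1) m) (hzh : toPoly T zh = C X * toPoly T h)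
    (hph : p = zh - α • h) : h ∈ K₁ := by
  have hn : (n : ℤ) - 1 ≤ n := by omega
  have hP : trace T p = (X - C α) * trace T h := by
    rw [hph, map_sub, map_smul, trace_apply, hzh, coeff_C_mul, sub_mul, smul_eq_C_mul]
    rfl
  obtain ⟨a, b, hab, ha, hb⟩ := exists_stable_mul (c := trace T p) fun z hz => by
    rw [← evalH_zero_right]
    exact hs.evalH_ne_zero hp hp1 hz (by simp)
  have hbα : b.IsRoot α := by
    have h1 := congrArg (eval α) (hP.symm.trans hab)
    simp only [eval_mul, eval_sub, eval_X, eval_C, sub_self, zero_mul] at h1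
    exact (mul_eq_zero.1 h1.symm).resolve_left (ha α hα.le)
  obtain ⟨b', hb'⟩ := dvd_iff_isRoot.2 hbα
  have hb0 := hb.ne_zero
  have hb0' : b' ≠ 0 := by
    rintro rfl
    exact hb0 (by rw [hb', mul_zero])
  have hbdeg : b.natDegree = b'.natDegree + 1 := by
    rw [hb', natDegree_mul (X_sub_C_ne_zero α) hb0', natDegree_X_sub_C, add_comm]
  have htr : trace T h = b' * a := by
    apply mul_left_cancel₀ (X_sub_C_ne_zero α)
    rw [← hP, hab, hb']
    ring
  have hdeg : a.natDegree + b.natDegree ≤ n := by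
    rw [← natDegree_mul ha.ne_zero hb0, ← hab]
    exact trace_natDegree_le p
  -- The projection f is in K₁ by the trace formula for K₁. It remains to show that the error G = h
  -- - f, a multiple of w, vanishes.
  set f := (E1 T (n - 1) m).starProjection h with hf
  have hfE : f ∈ E1 T (n - 1) m := Submodule.starProjection_apply_mem _ _
  have hftr : trace T f = trace T h := trace_starProjection T hn hh
  have hfK : f ∈ K₁ := by
    rw [(hs.eq_projSpan hp hp1 hab ha hb).1]
    refine mem_projSpan hdeg ?_ hfE (hftr.trans htr)
    rw [mem_degreeLT, degree_eq_natDegree hb0']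
    exact_mod_cast (by omega : b'.natDegree < b.natDegree)
  have hG : h - f ∈ wSpace T (n - 1) :=
    mem_wSpace_of_trace hn (sub_mem hh (E1_le_polyH T _ hfE)) (by rw [map_sub, hftr, sub_self])
  set G := h - f with hGdef
  obtain ⟨zf, -, hzf⟩ := exists_C_X_mul le_rfl (E1_le_polyH T _ hfE)
  obtain ⟨zG, -, hzG⟩ := exists_C_X_mul le_rfl (wSpace_le T _ hG)
  have hzGw : zG ∈ wSpace T n := by
    refine mem_wSpace_of_trace le_rfl (toPoly_mem T _) ?_
    rw [trace_apply, hzG, coeff_C_mul, ← trace_apply, trace_of_mem_wSpace hG, mul_zero]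
  have hpsum : p = zf + zG - α • (f + G) := by
    have h1 : zh = zf + zG := toPoly_injective T (by
      rw [hzh, map_add, hzf, hzG, ← mul_add, ← map_add, hGdef, add_sub_cancel])
    rw [hph, h1, hGdef, add_sub_cancel]
  have h1 : inner ℂ zG p = 0 := (wSpace_ortho_E1 T le_rfl).inner_eq hzGw hp.1
  have h2 : inner ℂ zG f = 0 := (wSpace_ortho_E1 T le_rfl).inner_eq hzGw (hs.le hfK)
  have h3 : inner ℂ zG zf = 0 := by
    rw [inner_C_X_mul hzG hzf]
    exact (wSpace_ortho_E1 T hn).inner_eq hG hfE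
  have h4 : inner ℂ zG zG = inner ℂ G G := inner_C_X_mul hzG hzG
  -- zG is orthogonal to p, f and zf, so pairing it with p = zf + zG - α(f + G) leaves ‖G‖² = α ⟨G,
  -- zG⟩. By Cauchy–Schwarz and |α| < 1, G = 0.
  rw [hpsum, inner_sub_right, inner_add_right, inner_smul_right, inner_add_right, h2, h3, h4,
    zero_add, zero_add, sub_eq_zero, inner_self_eq_norm_sq_to_K] at h1
  have h5 := congrArg norm h1
  rw [norm_pow, RCLike.norm_ofReal, abs_norm, norm_mul] at h5
  have h6 := norm_inner_le_norm (𝕜 := ℂ) zG G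
  rw [norm_C_X_mul hzG] at h6
  have h7 : ‖G‖ = 0 := by
    by_contra h0
    have h8 : 0 < ‖G‖ := lt_of_le_of_ne (norm_nonneg _) (Ne.symm h0)
    have h9 := mul_le_mul_of_nonneg_left h6 (norm_nonneg α)
    nlinarith [mul_pos h8 h8]
  rw [norm_eq_zero, hGdef, sub_eq_zero] at h7
  rwa [h7]

/-- Moving a zero of a split-poly out of the disk gives a split-poly. -/
theorem IsShiftSplit.flip (hs : IsShiftSplit T K₁ K₂) {p : HT T}
    (hp : p ∈ E1 T n m ⊓ (K₁ ⊔ zShift T K₂)ᗮ) (hp1 : ‖p‖ = 1) {α : ℂ} (hα : ‖α‖ < 1)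
    {h zh : HT T} (hh : h ∈ polyH T (n - 1) m) (hzh : toPoly T zh = C X * toPoly T h)
    (hph : p = zh - α • h) :
    IsSplitPoly T (toPoly T (h - starRingEnd ℂ α • zh)) := by
  have hhK := hs.mem_of_X_sub_C_mul hp hp1 hα hh hzh hph
  have hzh' : zh = p + α • h := by rw [hph]; abel
  have hspan : (ℂ ∙ h) ≤ K₁ := (Submodule.span_singleton_le_iff_mem _ _).2 hhK
  have hzhE : zh ∈ E1 T n m := by
    rw [hzh']
    exact add_mem hp.1 (Submodule.smul_mem _ _ (hs.le hhK))
  -- The new shift-split transfers the line of h from K₁ to K₂. It works because zh = p + αh lies in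
  -- 𝓔¹_{n,m} and is orthogonal to both L and zK₂.
  set L := (ℂ ∙ h)ᗮ ⊓ K₁ with hL
  have hpK₁ : ∀ f ∈ K₁, inner ℂ f p = 0 := fun f hf =>
    (Submodule.mem_orthogonal _ _).1 hp.2 f (Submodule.mem_sup_left hf)
  have hpK₂ : ∀ f ∈ zShift T K₂, inner ℂ f p = 0 := fun f hf =>
    (Submodule.mem_orthogonal _ _).1 hp.2 f (Submodule.mem_sup_right hf)
  have hLh : ∀ f ∈ L, inner ℂ f h = 0 := fun f hf =>
    (Submodule.mem_orthogonal' _ _).1 hf.1 h (Submodule.mem_span_singleton_self h)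
  have hLzh : ∀ f ∈ L, inner ℂ f zh = 0 := fun f hf => by
    rw [hzh', inner_add_right, inner_smul_right, hpK₁ f hf.2, hLh f hf, mul_zero, add_zero]
  have hK₂h : ∀ f ∈ zShift T K₂, inner ℂ f h = 0 := fun f hf =>
    hs.ortho_shift.symm.inner_eq hf hhK
  have hK₂zh : ∀ f ∈ zShift T K₂, inner ℂ f zh = 0 := fun f hf => by
    rw [hzh', inner_add_right, inner_smul_right, hpK₂ f hf, hK₂h f hf, mul_zero, add_zero]
  have hle := zShift_sup_span_le hs.le_polyH₂ hzh
  have hLK : L ≤ K₁ := inf_le_right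
  have hsplit : IsShiftSplit T L (K₂ ⊔ (ℂ ∙ h)) := by
    refine ⟨?_, ?_, ?_, hLK.trans hs.le, ?_⟩
    · rw [← hs.sup_eq, sup_comm K₂, ← sup_assoc, sup_comm L,
        Submodule.sup_orthogonal_inf_of_hasOrthogonalProjection hspan]
    · rw [Submodule.isOrtho_sup_right]
      exact ⟨hs.ortho.mono_left hLK, (Submodule.isOrtho_orthogonal_left _).mono_left inf_le_left⟩
    · refine Submodule.IsOrtho.mono_right hle (Submodule.isOrtho_sup_right.2
        ⟨hs.ortho_shift.mono_left hLK, ?_⟩)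
      rw [Submodule.isOrtho_iff_inner_eq]
      intro f hf g hg
      obtain ⟨c, rfl⟩ := Submodule.mem_span_singleton.1 hg
      rw [inner_smul_right, hLzh f hf, mul_zero]
    · exact hle.trans (sup_le hs.shift_le ((Submodule.span_singleton_le_iff_mem _ _).2 hzhE))
  have hzz : inner ℂ zh zh = inner ℂ h h := inner_C_X_mul hzh hzh
  have hzhh : inner ℂ zh h = starRingEnd ℂ α * inner ℂ h h := by
    rw [hzh', inner_add_left, inner_smul_left, inner_eq_zero_symm.1 (hpK₁ h hhK), zero_add]
  refine ⟨L, _, hsplit, _, rfl, ⟨?_, ?_⟩, ?_⟩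
  · exact sub_mem (hs.le hhK) (Submodule.smul_mem _ _ hzhE)
  · refine (Submodule.mem_orthogonal _ _).2 fun f hf => ?_
    obtain ⟨x, hx, y, hy, rfl⟩ := Submodule.mem_sup.1 hf
    obtain ⟨y', hy', u, hu, rfl⟩ := Submodule.mem_sup.1 (hle hy)
    obtain ⟨c, rfl⟩ := Submodule.mem_span_singleton.1 hu
    simp only [inner_add_left, inner_sub_right, inner_smul_right, inner_smul_left, hLh x hx,
      hLzh x hx, hK₂h y' hy', hK₂zh y' hy', hzhh, hzz]
    ring
  -- As ‖zh‖ = ‖h‖, both squares expand to (1 + |α|²)‖h‖² minus the same cross term.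
  · have h1 : ‖h - starRingEnd ℂ α • zh‖ ^ 2 = ‖p‖ ^ 2 := by
      rw [hph, norm_sub_sq (𝕜 := ℂ), norm_sub_sq (𝕜 := ℂ), norm_smul, norm_smul,
        norm_C_X_mul hzh, RCLike.norm_conj, inner_smul_right, inner_smul_right,
        ← inner_conj_symm h zh, ← map_mul, RCLike.conj_re]
    rw [hp1, one_pow] at h1
    exact (pow_eq_one_iff_of_nonneg (norm_nonneg _) two_ne_zero).1 h1

end

theorem C_C_mul (c : ℂ) (p : ℂ[X][Y]) : C (C c) * p = c • p := by
  ext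
  simp

theorem IsSplitPoly.flip {T : PositiveForm n m} {α : ℂ} (hα : ‖α‖ < 1) {h : ℂ[X][Y]}
    (hp : IsSplitPoly T (C (X - C α) * h)) : IsSplitPoly T (C (reflection (X - C α)) * h) := by
  obtain ⟨K₁, K₂, hs, p, hph, hp, hp1⟩ := hp
  have hh : h ∈ polySpace (n - 1) m := by
    have := mem_polySpace_of_C_mul (X_sub_C_ne_zero α) (hph ▸ toPoly_mem T p)
    rwa [natDegree_X_sub_C, Nat.cast_one] at this
  set hH := ofPoly T h (polySpace_mono (by omega) le_rfl hh)
  obtain ⟨zh, -, hzh⟩ := exists_C_X_mul (T := T) (f := hH) le_rfl hh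
  have := hs.flip hp hp1 hα hh hzh (toPoly_injective T (by
    rw [hph, map_sub (toPoly T), map_smul (toPoly T), hzh, ← C_C_mul, ← sub_mul, ← C_sub]
    rfl))
  convert this using 1
  rw [reflection_X_sub_C, map_sub (toPoly T), map_smul (toPoly T), hzh, ← C_C_mul, ← mul_assoc, ← C_mul, C_sub, C_1,
    sub_mul, one_mul]
  rfl

theorem IsSplitPoly.smul {T : PositiveForm n m} {p : ℂ[X][Y]} (hp : IsSplitPoly T p) {c : ℂ}
    (hc : ‖c‖ = 1) : IsSplitPoly T (c • p) := by
  obtain ⟨K₁, K₂, hs, f, rfl, hf, hf1⟩ := hp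
  exact ⟨K₁, K₂, hs, c • f, map_smul _ _ _, Submodule.smul_mem _ _ hf, by
    rw [norm_smul, hc, hf1, one_mul]⟩

/-- The zeros of b are flipped one at a time; a leftover constant β turns into its conjugate, a
unimodular change. -/
theorem IsSplitPoly.reflection_mul {T : PositiveForm n m} {b : ℂ[X]} (hb : AllZerosInDisk b)
    {h : ℂ[X][Y]} (hp : IsSplitPoly T (C b * h)) : IsSplitPoly T (C (reflection b) * h) := by
  have hb0 := hb.ne_zero
  induction hd : b.natDegree generalizing b h with
  | zero =>
    obtain ⟨β, rfl⟩ : ∃ β, b = C β := ⟨_, eq_C_of_natDegree_eq_zero hd⟩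
    have hβ : β ≠ 0 := C_ne_zero.1 hb0
    rw [reflection_C, C_C_mul]
    have h1 : starRingEnd ℂ β • h = (starRingEnd ℂ β / β) • (C (C β) * h) := by
      rw [C_C_mul, smul_smul, div_mul_cancel₀ _ hβ]
    rw [h1]
    refine hp.smul ?_
    rw [norm_div, Complex.norm_conj, div_self (norm_ne_zero_iff.2 hβ)]
  | succ d ih =>
    obtain ⟨α, hα⟩ := IsAlgClosed.exists_root b (by
      rw [degree_eq_natDegree hb0, hd]
      exact_mod_cast Nat.succ_ne_zero d)
    have hα1 := hb α hα
    obtain ⟨b', rfl⟩ := dvd_iff_isRoot.2 hα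
    have hb' := right_ne_zero_of_mul hb0
    rw [C_mul, mul_assoc] at hp
    have h1 := hp.flip hα1
    rw [mul_left_comm] at h1
    have h2 := ih (fun z hz => hb z (by simp [hz])) h1 hb' (by
      rw [natDegree_mul (X_sub_C_ne_zero α) hb', natDegree_X_sub_C] at hd
      omega)
    rwa [SplitShift.reflection_mul, C_mul, mul_assoc, mul_left_comm]

/-! ### Primitive parts -/

theorem exists_isPrimitive (p : ℂ[X][Y]) : ∃ (c : ℂ[X]) (g : ℂ[X][Y]), p = C c * g ∧
    g.IsPrimitive := by
  classical
  let _ := UniqueFactorizationMonoid.toNormalizedGCDMonoid ℂ[X]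
  exact ⟨p.content, p.primPart, p.eq_C_content_mul_primPart, p.isPrimitive_primPart⟩

theorem dvd_of_C_dvd_C_mul {g : ℂ[X][Y]} (hg : g.IsPrimitive) {r s : ℂ[X]}
    (h : C r ∣ C s * g) : r ∣ s := by
  classical
  let _ := UniqueFactorizationMonoid.toNormalizedGCDMonoid ℂ[X]
  have h1 := (dvd_content_iff_C_dvd.2 h).trans (associated_content_C_mul s g).dvd
  rwa [hg.content_eq_one, mul_one] at h1

/-- Split-polys are proportional over ℂ(z); primitivity of g (Gauss's lemma) clears the denominator.
-/
theorem IsSplitPoly.exists_eq_C_mul {T : PositiveForm n m} {c : ℂ[X]} {g p : ℂ[X][Y]}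
    (hp₀ : IsSplitPoly T (C c * g)) (hg : g.IsPrimitive) (hp : IsSplitPoly T p) :
    ∃ c', p = C c' * g := by
  have h1 := hp₀.C_mul_eq hp
  have h2 := hp₀.noZerosTD.eval_coeff_zero_ne (norm_one (α := ℂ))
  generalize (C c * g).coeff 0 = P at h1 h2
  have hP : P ≠ 0 := by
    rintro rfl
    exact h2 eval_zero
  rw [← mul_assoc, ← C_mul] at h1
  obtain ⟨c', hc'⟩ := dvd_of_C_dvd_C_mul hg ⟨p, h1.symm⟩
  rw [hc', C_mul, mul_assoc] at h1
  exact ⟨c', mul_left_cancel₀ (C_ne_zero.2 hP) h1⟩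

theorem noFactorInZ_of_isPrimitive {g : ℂ[X][Y]} (hg : g.IsPrimitive) : NoFactorInZ g := by
  rintro f hf hfg ⟨r, rfl⟩
  exact hf.not_isUnit (isUnit_C.2 (hg r hfg))

end

end SplitShift

/-! ### The theorem -/

theorem mainTheorem11 (n m : ℕ) (T : SplitShift.PositiveForm n m)
    (hT : SplitShift.SplitShiftCondition T) :
    ∃ (g : ℂ[X][Y]) (q : ℂ[X]),
      SplitShift.NoZerosTD g ∧ SplitShift.NoFactorInZ g ∧ SplitShift.Stable q ∧
      SplitShift.IsSplitPoly T (C q * g) ∧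
      ∃ g₁ g₂ : ℂ[X],
        -- `g(z,0) = g₁(z) g₂(z)`
        g.coeff 0 = g₁ * g₂ ∧ SplitShift.Stable g₁ ∧ SplitShift.AllZerosInDisk g₂ ∧
        ∀ (p : ℂ[X][Y]), SplitShift.IsSplitPoly T p →
          (∃ q₁ q₂ : ℂ[X], p = C (q₁ * q₂) * g ∧
            (q₁ * q₂).natDegree + SplitShift.degZ g ≤ n ∧
            q = q₁ * SplitShift.reflection q₂) ∧
          ∀ q₁ q₂ : ℂ[X], p = C (q₁ * q₂) * g → q = q₁ * SplitShift.reflection q₂ →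
            ∀ K₁ K₂ : Submodule ℂ (SplitShift.HT T), SplitShift.IsSplitPolyOf T K₁ K₂ p →
              K₁ = SplitShift.projSpan T (q₁ * g₁) (q₂.natDegree + g₂.natDegree) ∧
              K₂ = SplitShift.projSpan T (q₂ * g₂) (n - q₂.natDegree - g₂.natDegree) := by
  open SplitShift in
  obtain ⟨K₁, K₂, hs⟩ := hT
  obtain ⟨p₀, hp₀'⟩ := hs.exists_splitPoly
  have hp₀ : IsSplitPoly T p₀ := ⟨K₁, K₂, hp₀'⟩
  obtain ⟨c, g, rfl, hg⟩ := exists_isPrimitive p₀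
  have hne := hp₀.noZerosTD
  have hgT : NoZerosTD g := fun z w hz hw h0 => hne z w hz hw (by rw [evalEval_mul, h0, mul_zero])
  have hcT : ∀ z : ℂ, ‖z‖ = 1 → c.eval z ≠ 0 := fun z hz h0 =>
    hne z 0 hz (by simp) (by rw [evalEval_mul, evalEval_C, h0, zero_mul])
  have hg0 : g ≠ 0 := by
    rintro rfl
    exact hgT 1 0 (by simp) (by simp) (by simp [evalEval])
  obtain ⟨c₁, c₂, rfl, hc₁, hc₂⟩ := exists_stable_mul hcT
  obtain ⟨g₁, g₂, hg12, hg₁, hg₂⟩ := exists_stable_mul fun z hz => hgT.eval_coeff_zero_ne hz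
  have hqs := hc₁.mul hc₂.stable_reflection
  refine ⟨g, c₁ * reflection c₂, hgT, noFactorInZ_of_isPrimitive hg, hqs, ?_, g₁, g₂, hg12, hg₁,
    hg₂, fun p hp => ⟨?_, ?_⟩⟩
  · rw [mul_comm c₁, C_mul, mul_assoc] at hp₀
    have h2 := hp₀.reflection_mul hc₂
    rwa [← mul_assoc, ← C_mul, mul_comm (reflection c₂)] at h2
  · obtain ⟨c', hpc⟩ := hp₀.exists_eq_C_mul hg hp
    have hnorm : ∀ z : ℂ, ‖z‖ = 1 → ‖c'.eval z‖ = ‖(c₁ * c₂).eval z‖ := by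
      intro z hz
      have h2 := hp.norm_eq hp₀ hz
      rw [hpc, coeff_C_mul, coeff_C_mul, Polynomial.eval_mul, Polynomial.eval_mul, norm_mul,
        norm_mul] at h2
      exact mul_right_cancel₀ (norm_ne_zero_iff.2 (hgT.eval_coeff_zero_ne hz)) h2
    obtain ⟨a, b, rfl, ha, hb⟩ := exists_stable_mul (c := c') fun z hz h0 => by
      have h2 := hnorm z hz
      rw [h0, norm_zero] at h2
      exact hcT z hz (norm_eq_zero.1 h2.symm)
    obtain ⟨l, hl, hql⟩ := hqs.eq_of_norm_eq (ha.mul hb.stable_reflection) fun z hz => by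
      have h2 := hnorm z hz
      simp only [eval_mul, norm_mul, norm_eval_reflection _ hz] at h2 ⊢
      exact h2.symm
    -- The unimodular constant l is shared out: with q₁ = s a and q₂ = s̄ b the product ab is
    -- unchanged, while q₁ times the reflection of q₂ gains s² = l.
    obtain ⟨s, hs2⟩ := IsAlgClosed.exists_pow_nat_eq l (n := 2) two_pos
    have hs1 : ‖s‖ = 1 := by
      rw [← hs2, norm_pow] at hl
      exact (pow_eq_one_iff_of_nonneg (norm_nonneg _) two_ne_zero).1 hl
    have hss : s * starRingEnd ℂ s = 1 := by
      rw [SplitShift.mul_conj_eq, hs1]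
      simp
    have hab : C s * a * (C (starRingEnd ℂ s) * b) = a * b := by
      rw [mul_mul_mul_comm, ← C_mul, hss, C_1, one_mul]
    refine ⟨C s * a, C (starRingEnd ℂ s) * b, by rw [hab, hpc], ?_, ?_⟩
    · rw [hab]
      exact natDegree_add_degZ_le (mul_ne_zero ha.ne_zero hb.ne_zero) hg0
        (hpc ▸ hp.mem_polySpace)
    · rw [hql, SplitShift.reflection_mul, reflection_C, Complex.conj_conj, ← hs2, C_pow]
      ring
  · rintro q₁ q₂ rfl hq L₁ L₂ ⟨hL, f, hfp, hf, hf1⟩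
    -- Any admissible factorization inherits from the stable q that q₁ is stable and q₂ has all
    -- zeros in the disk. So q₁g₁ and q₂g₂ are the two parts of p(z,0) that determine the
    -- shift-split.
    rw [hq] at hqs
    have hq₁ : Stable q₁ := fun z hz h0 => hqs z hz (by rw [eval_mul, h0, zero_mul])
    have hq₂ : AllZerosInDisk q₂ := allZerosInDisk_of_stable_reflection fun z hz h0 =>
      hqs z hz (by rw [eval_mul, h0, mul_zero])
    have htr : trace T f = q₁ * g₁ * (q₂ * g₂) := by
      rw [trace_apply, hfp, coeff_C_mul, hg12]
      ring
    have := hL.eq_projSpan hf hf1 htr (hq₁.mul hg₁) (hq₂.mul hg₂)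
    rwa [natDegree_mul hq₂.ne_zero hg₂.ne_zero, ← Nat.sub_sub] at this
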